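/- Let $k$ be an algebraically closed field, let $T$ be a finite nonabelian simple group, let $\ell$ be a positive integer and let $G = T^\ell$. Let $\gamma : H \to G$ be a finite proper minimal extension, that is, $H$ is a finite group and $\gamma$ is a surjective group homomorphism that is not an isomorphism, such that $K\gamma < G$ for every proper subgroup $K < H$. Let $n'_T$ be the least $n$ such that $T$ is isomorphic to an irreducible subgroup of $\mathrm{GL}_{2n}(2)$. A projective representation of $H$ of dimension $m$ is a homomorphism $\lambda : H \to \mathrm{PGL}_m(k)$; it is faithful if it is injective. Let $V = k^m$ and let $\widehat{H} \leq \mathrm{GL}(V)$ be the full preimage of $H\lambda$. Then $\lambda$ is irreducible if $\widehat{H}$ acts irreducibly on $V$; it is imprimitive if $\widehat{H}$ permutes among themselves the nonzero subspaces $V_1, \dots, V_r$ in a direct sum decomposition $V = \bigoplus_{i=1}^r V_i$ with $r > 1$; and it is primitive if it is not imprimitive. 1. If $\mathrm{char}\, k = 2$, then $H$ has no faithful irreducible primitive projective representation over $k$. 2. If $\mathrm{char}\, k \neq 2$, then every faithful irreducible primitive projective representation of $H$ over $k$ has dimension at least $\ell \cdot 2^{n'_T}$. -/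

import Mathlib

open scoped MatrixGroups

/-- The natural representation of `GL_m(k)` on the space of column vectors `k^m`. -/
def naturalRep (k : Type*) [Field k] (m : ℕ) :
    Representation k (GL (Fin m) k) (Fin m → k) :=
  (Units.coeHom (Module.End k (Fin m → k))).comp
    (Matrix.GeneralLinearGroup.toLin (n := Fin m) (R := k)).toMonoidHom

/-- A homomorphism `γ : H → G` is a minimal extension of `G` if it is surjective and every proper
subgroup of `H` has proper image in `G`. -/
structure IsMinimalExtension {H G : Type*} [Group H] [Group G] (γ : H →* G) : Prop where
  surjective : Function.Surjective γ
  map_lt_top : ∀ K : Subgroup H, K < ⊤ → K.map γ < ⊤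

/-- `nPrime T` is the least `n` such that `T` embeds in `GL_{2n}(2)` as an irreducible subgroup. -/
noncomputable def nPrime (T : Type*) [Group T] : ℕ :=
  sInf {n : ℕ | ∃ ρ : T →* GL (Fin (2 * n)) (ZMod 2),
    Function.Injective ρ ∧
      Representation.IsIrreducible ((naturalRep (ZMod 2) (2 * n)).comp ρ)}

namespace ProjRep

variable {H k : Type*} [Group H] [Field k] {m : ℕ}

/-- The full preimage in `GL_m(k)` of the image of a projective representation
`H → PGL_m(k)`. -/
def linearPreimage (lam : H →* PGL(Fin m, k)) : Subgroup (GL (Fin m) k) :=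
  lam.range.comap Matrix.ProjGenLinGroup.mk

/-- A projective representation is irreducible if the preimage of `H` in `GL(V)`
acts irreducibly on `V = k^m`. -/
def IsIrreducible (lam : H →* PGL(Fin m, k)) : Prop :=
  Representation.IsIrreducible ((naturalRep k m).comp (linearPreimage lam).subtype)

/-- A projective representation is imprimitive if the preimage of `H` in `GL(V)` permutes among
themselves the (nonzero) summands of a direct sum decomposition `V = V_1 ⊕ ⋯ ⊕ V_r`
with `r > 1`. -/
def IsImprimitive (lam : H →* PGL(Fin m, k)) : Prop :=
  ∃ (r : ℕ) (V : Fin r → Submodule k (Fin m → k)),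
    1 < r ∧ (∀ i, V i ≠ ⊥) ∧ DirectSum.IsInternal V ∧
      ∀ g ∈ linearPreimage lam, ∀ i, ∃ j, (V i).map (naturalRep k m g) = V j

/-- A projective representation is primitive if it is not imprimitive. -/
def IsPrimitive (lam : H →* PGL(Fin m, k)) : Prop :=
  ¬ IsImprimitive lam

end ProjRep

/-!
Let `Γ ≤ GL(V)` be the full preimage of a faithful irreducible primitive projective representation
of `H`, and let `N` be the kernel of the minimal extension `γ : H → T^l`. By minimality `N` lies in
the Frattini subgroup of `H`, so it is nilpotent. By primitivity a normal abelian subgroup of `Γ`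
is scalar (`exists_scalar_of_normal_of_commute`), because its weight spaces are permuted by `Γ`.
Hence commutators in `Γ` define nondegenerate alternating pairings, with values in `kˣ`, on the
normal subgroups of `H` that are abelian; this forces `N` to be abelian
(`IsPrimitiveLift.commute_of_isNilpotent`).

The `p`-torsion of `N` for odd `p` has a supplement in `H`, because the extension of the symplectic
group by the Heisenberg group splits in odd exponent (`exists_supplement_of_odd`); minimality makes
this torsion trivial. The squares in the `4`-torsion are isotropic, hence trivial. So `N` is an
elementary abelian `2`-group, nontrivial as `γ` is not injective, and in characteristic two the
pairing, whose values are square roots of unity, would be trivial: this is the first claim.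

Otherwise `N` is a symplectic `T^l`-module over the field with two elements, all of whose submodules
are nondegenerate. If `j` of the factors `T` act nontrivially on it, then `|N| ≥ 4 ^ (j * n')` with
`n' = nPrime T` (`card_mul_two_mul_nPrime_le_finrank`): an irreducible submodule for one factor has
even dimension by self-duality, hence dimension at least `2 * n'`, and each further factor that acts
nontrivially on the same irreducible summand doubles the dimension
(`two_mul_le_finrank_of_stableUnder`). Subspaces of `V` stable under the preimage of `N` have
dimension at least `|N| ^ (1/2)`, by linear independence of the operators. The remaining `l - j`
factors lift to groups that commute with the preimage of `N` and with each other, and by the same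
doubling lemma the dimension of `V` is at least `2 ^ (j * n' + l - j) ≥ l * 2 ^ n'`; here `j ≥ 1`,
as the kernel is not central in `H`.
-/

/-! ### Stable subspaces and the doubling of dimensions -/

section StableSubspaces

variable {F Γ V : Type*} [Field F] [Group Γ] [AddCommGroup V] [Module F V]

/-- The subspace `U` is mapped into itself by every operator `ρ g` with `g` in the set `S`. -/
def StableUnder (ρ : Representation F Γ V) (S : Set Γ) (U : Submodule F V) : Prop :=
  ∀ g ∈ S, ∀ v ∈ U, ρ g v ∈ U

theorem StableUnder.mono {ρ : Representation F Γ V} {S S' : Set Γ} {U : Submodule F V}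
    (h : StableUnder ρ S' U) (hS : S ⊆ S') : StableUnder ρ S U :=
  fun g hg v hv => h g (hS hg) v hv

theorem StableUnder.inf {ρ : Representation F Γ V} {S : Set Γ} {U W : Submodule F V}
    (hU : StableUnder ρ S U) (hW : StableUnder ρ S W) : StableUnder ρ S (U ⊓ W) :=
  fun g hg v hv => ⟨hU g hg v hv.1, hW g hg v hv.2⟩

theorem StableUnder.map_of_commute {ρ : Representation F Γ V} {S : Set Γ} {U : Submodule F V}
    (hU : StableUnder ρ S U) {b : Γ} (hb : ∀ x ∈ S, Commute x b) :
    StableUnder ρ S (U.map (ρ b)) := by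
  rintro g hg _ ⟨u, hu, rfl⟩
  refine ⟨ρ g u, hU g hg u hu, ?_⟩
  rw [← Module.End.mul_apply, ← Module.End.mul_apply, ← map_mul, ← map_mul, (hb g hg).eq]

theorem Representation.injective_apply (ρ : Representation F Γ V) (g : Γ) :
    Function.Injective (ρ g) := by
  intro v w h
  have := congrArg (ρ g⁻¹) h
  simpa using this

theorem Representation.finrank_map (ρ : Representation F Γ V) (g : Γ) (U : Submodule F V) :
    Module.finrank F (U.map (ρ g)) = Module.finrank F U :=
  (Submodule.equivMapOfInjective (ρ g) (ρ.injective_apply g) U).finrank_eq.symm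

/-- A subspace is `S`-minimal if it is minimal among the nonzero `S`-stable subspaces. -/
def MinimalStable (ρ : Representation F Γ V) (S : Set Γ) (U : Submodule F V) : Prop :=
  U ≠ ⊥ ∧ StableUnder ρ S U ∧ ∀ W ≤ U, StableUnder ρ S W → W ≠ ⊥ → W = U

theorem exists_minimalStable_le [FiniteDimensional F V] (ρ : Representation F Γ V) (S : Set Γ)
    {U : Submodule F V} (hU : U ≠ ⊥) (hS : StableUnder ρ S U) :
    ∃ W ≤ U, MinimalStable ρ S W := by
  obtain ⟨W, ⟨hWU, hW, hWS⟩, hmin⟩ := WellFounded.has_min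
    (wellFounded_lt (α := Submodule F V))
    {W | W ≤ U ∧ W ≠ ⊥ ∧ StableUnder ρ S W} ⟨U, le_rfl, hU, hS⟩
  refine ⟨W, hWU, hW, hWS, fun W' hW' hS' hne => ?_⟩
  by_contra hneq
  exact hmin W' ⟨hW'.trans hWU, hne, hS'⟩ (lt_of_le_of_ne hW' hneq)

/-- Schur's lemma in the form needed here: if `F` is algebraically closed or finite, the operators
on a minimal `S`-stable subspace that commute with `S` commute with each other, since they lie in
a division algebra which is either `F` itself or a finite field. -/
theorem MinimalStable.commute_of_commute [FiniteDimensional F V] (hF : IsAlgClosed F ∨ Finite F)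
    {ρ : Representation F Γ V} {S : Set Γ} {U : Submodule F V} (hU : MinimalStable ρ S U)
    {b c : Γ} (hb : ∀ x ∈ S, Commute x b) (hc : ∀ x ∈ S, Commute x c)
    (hbU : ∀ u ∈ U, ρ b u ∈ U) (hcU : ∀ u ∈ U, ρ c u ∈ U) {u : V} (hu : u ∈ U) :
    ρ b (ρ c u) = ρ c (ρ b u) := by
  let f : S → Module.End F U := fun x => (ρ x.1).restrict (hU.2.1 x.1 x.2)
  let C : Subalgebra F (Module.End F U) := Subalgebra.centralizer F (Set.range f)
  have hmem : ∀ (g : Γ) (hg : ∀ u ∈ U, ρ g u ∈ U), (∀ x ∈ S, Commute x g) →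
      (ρ g).restrict hg ∈ C := by
    intro g hg hcomm
    rw [Subalgebra.mem_centralizer_iff]
    rintro _ ⟨x, rfl⟩
    ext v
    change ρ x.1 (ρ g v) = ρ g (ρ x.1 v)
    rw [← Module.End.mul_apply, ← Module.End.mul_apply, ← map_mul, ← map_mul, (hcomm x.1 x.2).eq]
  have hinj : ∀ e ∈ C, e ≠ 0 → Function.Injective e := by
    intro e he hne
    rw [← LinearMap.ker_eq_bot]
    by_contra hker
    have hmap : (LinearMap.ker e).map U.subtype ≠ ⊥ := by
      intro h
      exact hker (Submodule.map_injective_of_injective U.injective_subtype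
        (h.trans (Submodule.map_bot _).symm))
    have hst : StableUnder ρ S ((LinearMap.ker e).map U.subtype) := by
      rintro g hg _ ⟨v, hv, rfl⟩
      refine ⟨f ⟨g, hg⟩ v, ?_, rfl⟩
      have := congrArg (fun t : Module.End F U => t v)
        ((Subalgebra.mem_centralizer_iff F).1 he (f ⟨g, hg⟩) ⟨_, rfl⟩)
      have h0 : e v = 0 := hv
      simpa [h0] using this.symm
    have heq := hU.2.2 _ (Submodule.map_subtype_le _ _) hst hmap
    apply hne
    ext v
    have hv : (v : V) ∈ (LinearMap.ker e).map U.subtype := by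
      rw [heq]
      exact v.2
    obtain ⟨w, hw, hwv⟩ := hv
    have : w = v := Subtype.ext hwv
    subst this
    have h0 : e w = 0 := hw
    simp [h0]
  have : Nontrivial U := Submodule.nontrivial_iff_ne_bot.2 hU.1
  have : NoZeroDivisors C := by
    refine ⟨fun {a c} h => ?_⟩
    by_contra! hne
    have ha := hinj a a.2 (fun h => hne.1 (Subtype.ext h))
    have h' : (a : Module.End F U) * c = 0 := congrArg Subtype.val h
    apply hne.2
    apply Subtype.ext
    ext v
    have := congrArg (fun t : Module.End F U => t v) h'
    have h2 : (c : Module.End F U) v = 0 := ha (by simpa using this)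
    simp [h2]
  have : IsDomain C := NoZeroDivisors.to_isDomain C
  have hcomm : ∀ x y : C, x * y = y * x := by
    rcases hF with hF | hF
    · intro x y
      obtain ⟨a, rfl⟩ := (IsAlgClosed.algebraMap_bijective_of_isIntegral (k := F) (K := C)).2 x
      exact Algebra.commutes a y
    · have : Finite (Module.End F U) := Module.finite_of_finite F
      exact (Finite.isDomain_to_isField C).mul_comm
  have h := congrArg Subtype.val
    (hcomm ⟨_, hmem b hbU hb⟩ ⟨_, hmem c hcU hc⟩)
  exact congrArg (fun t : Module.End F U => ((t ⟨u, hu⟩ : U) : V)) h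

/-- Enlarging a set `X` of operators by a commuting group `B` whose derived group has no nonzero
fixed vector at least doubles the dimensions of the stable subspaces: inside a stable subspace take
a minimal `X`-stable `W`. If `B` preserved `W`, its derived group would fix `W` by Schur's lemma;
so some `b ∈ B` moves `W` to an `X`-stable subspace meeting `W` trivially. -/
theorem two_mul_le_finrank_of_stableUnder [FiniteDimensional F V] (hF : IsAlgClosed F ∨ Finite F)
    (ρ : Representation F Γ V) (M : Submodule F V) (X : Set Γ) (B : Subgroup Γ)
    (hXB : ∀ x ∈ X, ∀ b ∈ B, Commute x b)
    (hfix : ∀ v ∈ M, (∀ g ∈ ⁅B, B⁆, ρ g v = v) → v = 0) (d : ℕ)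
    (hd : ∀ U ≤ M, U ≠ ⊥ → StableUnder ρ X U → d ≤ Module.finrank F U) :
    ∀ U ≤ M, U ≠ ⊥ → StableUnder ρ (X ∪ B) U → 2 * d ≤ Module.finrank F U := by
  intro U hUM hU hst
  obtain ⟨W, hWU, hW⟩ := exists_minimalStable_le ρ X hU (hst.mono Set.subset_union_left)
  by_cases hmove : ∃ b ∈ B, ¬ W.map (ρ b) ≤ W
  · obtain ⟨b, hb, hbW⟩ := hmove
    have hst' := hW.2.1.map_of_commute (b := b) fun x hx => hXB x hx b hb
    have hinf : W ⊓ W.map (ρ b) = ⊥ := by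
      by_contra hne
      have h1 := hW.2.2 _ inf_le_left (hW.2.1.inf hst') hne
      have h2 : W ≤ W.map (ρ b) := inf_eq_left.1 h1
      have h3 := Submodule.eq_of_le_of_finrank_eq h2 (ρ.finrank_map b W).symm
      exact hbW h3.ge
    have hle : W ⊔ W.map (ρ b) ≤ U := by
      refine sup_le hWU ?_
      rintro _ ⟨w, hw, rfl⟩
      exact hst b (Or.inr hb) w (hWU hw)
    have hsum := Submodule.finrank_sup_add_finrank_inf_eq W (W.map (ρ b))
    rw [hinf, finrank_bot, ρ.finrank_map] at hsum
    have := Submodule.finrank_mono hle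
    have := hd W (hWU.trans hUM) hW.1 hW.2.1
    omega
  · push Not at hmove
    exfalso
    obtain ⟨w, hw, hw0⟩ := Submodule.exists_mem_ne_zero_of_ne_bot hW.1
    apply hw0
    let K : Subgroup Γ :=
      { carrier := {g | ∀ u ∈ W, ρ g u = u}
        one_mem' := by simp
        mul_mem' := by
          intro a c ha hc u hu
          rw [map_mul, Module.End.mul_apply, hc u hu, ha u hu]
        inv_mem' := by
          intro a ha u hu
          apply ρ.injective_apply a
          rw [ha u hu]
          simp }
    have hK : ⁅B, B⁆ ≤ K := by
      rw [Subgroup.commutator_le]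
      intro b hb c hc u hu
      have hB : ∀ g ∈ B, ∀ v ∈ W, ρ g v ∈ W := fun g hg v hv => hmove g hg ⟨v, hv, rfl⟩
      have hv : ρ c⁻¹ u ∈ W := hB _ (inv_mem hc) u hu
      have hv' : ρ b⁻¹ (ρ c⁻¹ u) ∈ W := hB _ (inv_mem hb) _ hv
      rw [commutatorElement_def]
      simp only [map_mul, Module.End.mul_apply]
      rw [hW.commute_of_commute hF (fun x hx => hXB x hx b hb) (fun x hx => hXB x hx c hc)
        (hB b hb) (hB c hc)]
      · simp only [← Module.End.mul_apply, ← map_mul]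
        simp
      · exact hv'
    exact hfix w (hUM (hWU hw)) fun g hg => hK hg w hw

/-- The doubling lemma, applied to finitely many pairwise commuting groups in turn. -/
theorem two_pow_mul_le_finrank_of_stableUnder [FiniteDimensional F V]
    (hF : IsAlgClosed F ∨ Finite F) (ρ : Representation F Γ V) (M : Submodule F V) (X : Set Γ)
    {ι : Type*} (B : ι → Subgroup Γ) (s : Finset ι)
    (hXB : ∀ i ∈ s, ∀ x ∈ X, ∀ b ∈ B i, Commute x b)
    (hBB : ∀ i ∈ s, ∀ j ∈ s, i ≠ j → ∀ x ∈ B i, ∀ b ∈ B j, Commute x b)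
    (hfix : ∀ i ∈ s, ∀ v ∈ M, (∀ g ∈ ⁅B i, B i⁆, ρ g v = v) → v = 0) (d : ℕ)
    (hd : ∀ U ≤ M, U ≠ ⊥ → StableUnder ρ X U → d ≤ Module.finrank F U) :
    ∀ U ≤ M, U ≠ ⊥ → StableUnder ρ (X ∪ ⋃ i ∈ s, (B i : Set Γ)) U →
      2 ^ s.card * d ≤ Module.finrank F U := by
  classical
  induction s using Finset.induction_on with
  | empty => simpa using hd
  | insert a s ha ih =>
    have ih' := ih (fun i hi => hXB i (Finset.mem_insert_of_mem hi))
      (fun i hi j hj => hBB i (Finset.mem_insert_of_mem hi) j (Finset.mem_insert_of_mem hj))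
      (fun i hi => hfix i (Finset.mem_insert_of_mem hi))
    intro U hUM hU hst
    have := two_mul_le_finrank_of_stableUnder hF ρ M (X ∪ ⋃ i ∈ s, (B i : Set Γ)) (B a) ?_
      (hfix a (Finset.mem_insert_self a s)) _ ih' U hUM hU (hst.mono ?_)
    · rw [Finset.card_insert_of_notMem ha, pow_succ]
      linarith
    · rintro x (hx | hx) b hb
      · exact hXB a (Finset.mem_insert_self a s) x hx b hb
      · obtain ⟨i, hi, hx⟩ := Set.mem_iUnion₂.1 hx
        exact hBB i (Finset.mem_insert_of_mem hi) a (Finset.mem_insert_self a s)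
          (fun h => ha (h ▸ hi)) x hx b hb
    · simp only [Finset.set_biUnion_insert]
      intro x
      simp only [Set.mem_union]
      tauto

/-- The fixed vectors of a normal subgroup form a stable subspace, so a normal subgroup acting
nontrivially on a minimal stable subspace has no nonzero fixed vector there. -/
theorem MinimalStable.eq_zero_of_fixed {ρ : Representation F Γ V} {M : Submodule F V}
    (hM : MinimalStable ρ Set.univ M) (K : Subgroup Γ) [K.Normal]
    (hK : ∃ g ∈ K, ∃ v ∈ M, ρ g v ≠ v) {v : V} (hv : v ∈ M) (hfix : ∀ g ∈ K, ρ g v = v) :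
    v = 0 := by
  let W : Submodule F V :=
    { carrier := {w | w ∈ M ∧ ∀ g ∈ K, ρ g w = w}
      zero_mem' := ⟨M.zero_mem, by simp⟩
      add_mem' := fun ha hb => ⟨M.add_mem ha.1 hb.1, fun g hg => by
        rw [map_add, ha.2 g hg, hb.2 g hg]⟩
      smul_mem' := fun c x hx => ⟨M.smul_mem c hx.1, fun g hg => by rw [map_smul, hx.2 g hg]⟩ }
  by_contra hne
  have hW : W ≠ ⊥ := fun h => hne ((Submodule.eq_bot_iff _).1 h v ⟨hv, hfix⟩)
  have hst : StableUnder ρ Set.univ W := by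
    intro g _ w hw
    refine ⟨hM.2.1 g trivial w hw.1, fun x hx => ?_⟩
    have h1 := hw.2 (g⁻¹ * x * g) (by
      simpa using (inferInstance : K.Normal).conj_mem x hx g⁻¹)
    have h2 := congrArg (ρ g) h1
    rw [← Module.End.mul_apply, ← map_mul] at h2
    rw [← Module.End.mul_apply, ← map_mul, ← h2]
    congr 2
    group
  have hWM := hM.2.2 W (fun w hw => hw.1) hst hW
  obtain ⟨g, hg, w, hw, hgw⟩ := hK
  rw [← hWM] at hw
  exact hgw (hw.2 g hg)

end StableSubspaces

/-! ### Symplectic modules over the field with two elements -/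

section Symplectic

/-- A nondegenerate alternating form lives in even dimension; the dimension is the parameter `n` of
an induction that splits off hyperbolic planes. -/
theorem even_finrank_of_isAlt {F : Type*} [Field F] (n : ℕ) :
    ∀ {U : Type*} [AddCommGroup U] [Module F U] [FiniteDimensional F U]
      (ω : LinearMap.BilinForm F U), ω.IsAlt → (∀ x, (∀ y, ω x y = 0) → x = 0) →
      Module.finrank F U = n → Even n := by
  induction n using Nat.strong_induction_on with
  | _ n ih =>
  intro U _ _ _ ω halt hnd hn
  by_cases hU : ∃ x : U, x ≠ 0
  swap
  · push Not at hU
    have : Subsingleton U := ⟨fun a b => by rw [hU a, hU b]⟩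
    rw [Module.finrank_zero_of_subsingleton] at hn
    simp [← hn]
  obtain ⟨x, hx⟩ := hU
  obtain ⟨y, hxy⟩ : ∃ y, ω x y ≠ 0 := by
    by_contra! h
    exact hx (hnd x h)
  have hyx : ω y x = - ω x y := (halt.neg_eq x y).symm
  have hxx := halt x
  have hyy := halt y
  -- the hyperbolic plane spanned by `x` and `y` splits off orthogonally
  have hind : LinearIndependent F ![x, y] := by
    rw [LinearIndependent.pair_iff]
    intro s t h
    have h1 := congrArg (ω x) h
    have h2 := congrArg (ω y) h
    simp only [map_add, map_smul, smul_eq_mul, map_zero, hxx, hyy, hyx, mul_zero, zero_add,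
      add_zero, mul_neg, neg_eq_zero, mul_eq_zero, hxy, or_false] at h1 h2
    exact ⟨h2, h1⟩
  set P : Submodule F U := Submodule.span F (Set.range ![x, y]) with hP
  have hPdim : Module.finrank F P = 2 := by
    rw [hP, finrank_span_eq_card hind, Fintype.card_fin]
  have hxP : x ∈ P := Submodule.subset_span ⟨0, rfl⟩
  have hyP : y ∈ P := Submodule.subset_span ⟨1, rfl⟩
  have hPx : ∀ z ∈ P, ∃ s t : F, z = s • x + t • y := by
    intro z hz
    rw [hP, Matrix.range_cons, Matrix.range_cons, Matrix.range_empty, Set.union_empty,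
      Set.singleton_union] at hz
    obtain ⟨s, t, h⟩ := Submodule.mem_span_pair.1 hz
    exact ⟨s, t, h.symm⟩
  have hdisj : Disjoint P (ω.orthogonal P) := by
    rw [Submodule.disjoint_def]
    intro z hz hzo
    obtain ⟨s, t, rfl⟩ := hPx z hz
    have h1 := hzo x hxP
    have h2 := hzo y hyP
    simp only [map_add, map_smul, smul_eq_mul, hxx, hyy, hyx, mul_zero, zero_add, add_zero, mul_neg,
      neg_eq_zero, mul_eq_zero, hxy, or_false] at h1 h2
    simp [h1, h2]
  have hcompl := (LinearMap.BilinForm.isCompl_orthogonal_iff_disjoint halt.isRefl).2 hdisj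
  have hsum := Submodule.finrank_add_eq_of_isCompl hcompl
  have hlt : Module.finrank F (ω.orthogonal P) < n := by omega
  have := ih _ hlt (ω.restrict (ω.orthogonal P)) (fun z => halt z) (fun z hz => ?_) rfl
  · rw [← hn, ← hsum, hPdim]
    exact even_two.add this
  · apply Subtype.ext
    apply hnd
    intro w
    obtain ⟨u, hu, v, hv, rfl⟩ := Submodule.mem_sup.1 (hcompl.sup_eq_top ▸ Submodule.mem_top :
      w ∈ P ⊔ ω.orthogonal P)
    rw [map_add, hz ⟨v, hv⟩ |> (fun h => (h : ω z v = 0)), add_zero]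
    exact halt.isRefl _ _ (z.2 u hu)

/-- A faithful irreducible `T`-module of dimension `2 * a` over the field with two elements gives,
in a basis, an irreducible subgroup of `GL_{2a}(2)` isomorphic to `T`. -/
theorem nPrime_le_of_representation {T U : Type*} [Group T] [AddCommGroup U] [Module (ZMod 2) U]
    [FiniteDimensional (ZMod 2) U] [Nontrivial U] (σ : Representation (ZMod 2) T U) {a : ℕ}
    (ha : Module.finrank (ZMod 2) U = 2 * a) (hinj : ∀ t, σ t = 1 → t = 1)
    (hirr : ∀ W : Submodule (ZMod 2) U, (∀ t, ∀ w ∈ W, σ t w ∈ W) → W = ⊥ ∨ W = ⊤) :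
    nPrime T ≤ a := by
  let e : U ≃ₗ[ZMod 2] (Fin (2 * a) → ZMod 2) := (Module.finBasisOfFinrankEq _ _ ha).equivFun
  let τ : T →* GL (Fin (2 * a)) (ZMod 2) :=
    (Matrix.GeneralLinearGroup.toLin (n := Fin (2 * a)) (R := ZMod 2)).symm.toMonoidHom.comp
      ((LinearMap.GeneralLinearGroup.congrLinearEquiv e).toMonoidHom.comp σ.toHomUnits)
  have hτ : ∀ t v, ((naturalRep (ZMod 2) (2 * a)).comp τ) t v = e (σ t (e.symm v)) := by
    intro t v
    simp [naturalRep, τ]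
  refine Nat.sInf_le ⟨τ, ?_, ?_⟩
  · rw [injective_iff_map_eq_one]
    intro t ht
    apply hinj
    ext u
    have := hτ t (e u)
    rw [MonoidHom.comp_apply, ht] at this
    simpa using this.symm
  · have : Nontrivial (Fin (2 * a) → ZMod 2) := e.symm.toEquiv.nontrivial
    refine { exists_pair_ne := ⟨⊥, ⊤, fun h => ?_⟩, eq_bot_or_eq_top := fun W => ?_ }
    · exact bot_ne_top (α := Submodule (ZMod 2) (Fin (2 * a) → ZMod 2))
        (congrArg Subrepresentation.toSubmodule h)
    · have key := hirr (W.toSubmodule.map (e.symm : _ →ₗ[ZMod 2] U)) (by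
        rintro t _ ⟨w, hw, rfl⟩
        refine ⟨_, W.apply_mem_toSubmodule t hw, ?_⟩
        rw [hτ]
        simp)
      refine key.imp (fun h => ?_) (fun h => ?_)
      · apply Subrepresentation.toSubmodule_injective
        rw [Submodule.map_eq_bot_iff] at h
        exact h
      · apply Subrepresentation.toSubmodule_injective
        rw [Submodule.map_eq_top_iff] at h
        exact h

end Symplectic

section SymplecticPower

open scoped commutatorElement

/-- Over the field with two elements, a nonzero bilinear form invariant under a group without
nonzero fixed vectors and without proper nonzero stable subspaces forces even dimension: the form
or its symmetrisation is alternating, and its radical is stable, hence zero. -/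
theorem even_finrank_of_invariant_form {T U : Type*} [Group T] [AddCommGroup U]
    [Module (ZMod 2) U] [FiniteDimensional (ZMod 2) U] (σ : Representation (ZMod 2) T U)
    (hirr : ∀ W : Submodule (ZMod 2) U, (∀ t, ∀ w ∈ W, σ t w ∈ W) → W = ⊥ ∨ W = ⊤)
    (hfix : ∀ v, (∀ t, σ t v = v) → v = 0)
    (β : LinearMap.BilinForm (ZMod 2) U) (hβ : β ≠ 0)
    (hinv : ∀ t x y, β (σ t x) (σ t y) = β x y) :
    Even (Module.finrank (ZMod 2) U) := by
  have key : ∀ δ : LinearMap.BilinForm (ZMod 2) U, δ ≠ 0 → δ.IsAlt →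
      (∀ t x y, δ (σ t x) (σ t y) = δ x y) → Even (Module.finrank (ZMod 2) U) := by
    intro δ hδ halt hδinv
    refine even_finrank_of_isAlt _ δ halt (fun x hx => ?_) rfl
    have hker : ∀ t, ∀ w ∈ LinearMap.ker δ, σ t w ∈ LinearMap.ker δ := by
      intro t w hw
      refine LinearMap.ext fun y => ?_
      have h1 : δ w (σ t⁻¹ y) = 0 := by
        rw [LinearMap.mem_ker.1 hw]
        simp
      rw [← hδinv t] at h1
      simpa using h1
    rcases hirr (LinearMap.ker δ) hker with h | h
    · have : x ∈ LinearMap.ker δ := LinearMap.ext hx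
      rw [h] at this
      exact this
    · exact absurd (LinearMap.ker_eq_top.1 h) hδ
  have hadd : ∀ z : ZMod 2, z + z = 0 := CharTwo.add_self_eq_zero
  by_cases hsymm : β + β.flip = 0
  · have hs : ∀ x y, β x y = β y x := by
      intro x y
      have := LinearMap.congr_fun₂ hsymm x y
      exact CharTwo.add_eq_zero.1 this
    -- the quadratic map `x ↦ β x x` of a symmetric form is linear over the field of two elements
    let q : U →ₗ[ZMod 2] ZMod 2 :=
      { toFun := fun x => β x x
        map_add' := fun x y => by
          simp only [map_add, LinearMap.add_apply]
          rw [hs y x]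
          linear_combination hadd (β x y)
        map_smul' := fun c x => by
          simp only [map_smul, LinearMap.smul_apply, smul_eq_mul, RingHom.id_apply]
          rw [← mul_assoc, ← pow_two, ZMod.pow_card] }
    have hq : ∀ t x, q (σ t x) = q x := fun t x => hinv t x x
    rcases hirr (LinearMap.ker q) (fun t w hw => by
      rw [LinearMap.mem_ker, hq]; exact hw) with h | h
    · exfalso
      apply hβ
      have h0 : ∀ x : U, x = 0 := by
        intro x
        refine hfix x fun t => ?_
        have : σ t x - x ∈ LinearMap.ker q := by
          rw [LinearMap.mem_ker, map_sub, hq, sub_self]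
        rw [h, Submodule.mem_bot, sub_eq_zero] at this
        exact this
      ext x y
      rw [h0 x]
      simp
    · exact key β hβ (fun x => by
        have : x ∈ LinearMap.ker q := h ▸ Submodule.mem_top
        exact this) hinv
  · refine key _ hsymm (fun x => ?_) (fun t x y => ?_)
    · exact hadd (β x x)
    · simp [hinv]

theorem commutator_eq_top_of_isSimpleGroup {T : Type*} [Group T] [IsSimpleGroup T]
    (hT : ¬ ∀ a b : T, a * b = b * a) : commutator T = ⊤ := by
  refine (inferInstance : (commutator T).Normal).eq_bot_or_eq_top.resolve_left fun h => hT ?_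
  intro a b
  have : ⁅a, b⁆ ∈ commutator T :=
    Subgroup.commutator_mem_commutator (Subgroup.mem_top a) (Subgroup.mem_top b)
  rw [h, Subgroup.mem_bot, commutatorElement_eq_one_iff_mul_comm] at this
  exact this

variable {T : Type*} [Group T] {l : ℕ}

instance normal_range_mulSingle (i : Fin l) :
    (MonoidHom.mulSingle (fun _ : Fin l => T) i).range.Normal := by
  refine ⟨?_⟩
  rintro _ ⟨t, rfl⟩ g
  refine ⟨g i * t * (g i)⁻¹, ?_⟩
  ext j
  by_cases h : j = i
  · subst h; simp
  · simp [h]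

theorem commutator_range_mulSingle [IsSimpleGroup T] (hT : ¬ ∀ a b : T, a * b = b * a)
    (i : Fin l) :
    ⁅(MonoidHom.mulSingle (fun _ : Fin l => T) i).range,
      (MonoidHom.mulSingle (fun _ : Fin l => T) i).range⁆ =
      (MonoidHom.mulSingle (fun _ : Fin l => T) i).range := by
  rw [MonoidHom.range_eq_map, ← Subgroup.map_commutator]
  congr 1
  exact commutator_eq_top_of_isSimpleGroup hT

theorem commute_of_mem_range_mulSingle {i j : Fin l} (hij : i ≠ j) {x y : Fin l → T}
    (hx : x ∈ (MonoidHom.mulSingle (fun _ : Fin l => T) i).range)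
    (hy : y ∈ (MonoidHom.mulSingle (fun _ : Fin l => T) j).range) : Commute x y := by
  obtain ⟨s, rfl⟩ := hx
  obtain ⟨t, rfl⟩ := hy
  exact Pi.mulSingle_commute (f := fun _ => T) hij s t

variable [IsSimpleGroup T] {W : Type*} [AddCommGroup W] [Module (ZMod 2) W]
  [FiniteDimensional (ZMod 2) W]

/-- If a factor `T` of `T^l` acts nontrivially on a minimal stable subspace `M` on which an
invariant form is nondegenerate, all nonzero subspaces `U ≤ M` stable under that factor have
dimension at least `2 * nPrime T`, and at least `2` even if `nPrime T` had the junk value `0`. For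
minimal `U` some form `(x, y) ↦ ω x (g y)` with `g` centralizing the factor is nonzero on `U`, since
the translates of `U` span `M`; so the dimension of `U` is even. -/
theorem two_mul_nPrime_le_finrank_of_minimalStable
    (ρ : Representation (ZMod 2) (Fin l → T) W) (ω : LinearMap.BilinForm (ZMod 2) W)
    (hinv : ∀ g x y, ω (ρ g x) (ρ g y) = ω x y) {M : Submodule (ZMod 2) W}
    (hM : MinimalStable ρ Set.univ M) (hnd : ∀ x ∈ M, (∀ y ∈ M, ω x y = 0) → x = 0)
    (halt : ω.IsAlt) (i : Fin l)
    (hi : ∃ t, ∃ v ∈ M, ρ (Pi.mulSingle i t) v ≠ v) :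
    ∀ U ≤ M, U ≠ ⊥ → StableUnder ρ (MonoidHom.mulSingle (fun _ : Fin l => T) i).range U →
      2 * max 1 (nPrime T) ≤ Module.finrank (ZMod 2) U := by
  intro U₀ hU₀M hU₀ hst₀
  obtain ⟨U, hUU₀, hU⟩ := exists_minimalStable_le ρ _ hU₀ hst₀
  refine le_trans ?_ (Submodule.finrank_mono hUU₀)
  have hUM := hUU₀.trans hU₀M
  have hfixM : ∀ v ∈ M, (∀ t, ρ (Pi.mulSingle i t) v = v) → v = 0 := by
    intro v hv h
    refine hM.eq_zero_of_fixed (MonoidHom.mulSingle (fun _ : Fin l => T) i).range ?_ hv ?_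
    · obtain ⟨t, v, hv, h⟩ := hi
      exact ⟨_, ⟨t, rfl⟩, v, hv, h⟩
    · rintro _ ⟨t, rfl⟩
      exact h t
  have hstU : ∀ t, ∀ u ∈ U, ρ (Pi.mulSingle i t) u ∈ U := fun t u hu => hU.2.1 _ ⟨t, rfl⟩ u hu
  let σ : Representation (ZMod 2) T U :=
    { toFun := fun t => (ρ (Pi.mulSingle i t)).restrict (hstU t)
      map_one' := by ext; simp
      map_mul' := fun s t => by ext; simp [Pi.mulSingle_mul] }
  have hσ : ∀ t (u : U), (σ t u : W) = ρ (Pi.mulSingle i t) u := fun _ _ => rfl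
  have : Nontrivial U := Submodule.nontrivial_iff_ne_bot.2 hU.1
  have hirr : ∀ Y : Submodule (ZMod 2) U, (∀ t, ∀ w ∈ Y, σ t w ∈ Y) → Y = ⊥ ∨ Y = ⊤ := by
    intro Y hY
    by_cases hYb : Y = ⊥
    · exact Or.inl hYb
    right
    have h := hU.2.2 (Y.map U.subtype) (Submodule.map_subtype_le _ _) (by
      rintro _ ⟨t, rfl⟩ _ ⟨w, hw, rfl⟩
      exact ⟨σ t w, hY t w hw, rfl⟩) (by
      intro h
      exact hYb (Submodule.map_injective_of_injective U.injective_subtype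
        (h.trans (Submodule.map_bot _).symm)))
    apply Submodule.map_injective_of_injective U.injective_subtype
    rw [h, Submodule.map_subtype_top]
  have hfix : ∀ v, (∀ t, σ t v = v) → v = 0 := fun v hv =>
    Subtype.ext (hfixM v (hUM v.2) fun t => congrArg Subtype.val (hv t))
  have hinj : ∀ t, σ t = 1 → t = 1 := by
    have hker : σ.ker = ⊥ := by
      refine (inferInstance : σ.ker.Normal).eq_bot_or_eq_top.resolve_right fun h => ?_
      obtain ⟨v, hv⟩ := exists_ne (0 : U)
      refine hv (hfix v fun t => ?_)
      have : t ∈ σ.ker := h ▸ Subgroup.mem_top t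
      rw [MonoidHom.mem_ker] at this
      rw [this]
      rfl
    intro t ht
    have : t ∈ σ.ker := ht
    rwa [hker, Subgroup.mem_bot] at this
  obtain ⟨g, hg, x, hx, y, hy, hxy⟩ : ∃ g : Fin l → T, g i = 1 ∧
      ∃ x ∈ U, ∃ y ∈ U, ω x (ρ g y) ≠ 0 := by
    by_contra! hzero
    have hzero' : ∀ g : Fin l → T, ∀ x ∈ U, ∀ y ∈ U, ω x (ρ g y) = 0 := by
      intro g x hx y hy
      have hdec : g = Function.update g i 1 * Pi.mulSingle i (g i) := by
        ext j
        by_cases h : j = i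
        · subst h; simp
        · simp [h]
      rw [hdec, map_mul, Module.End.mul_apply]
      exact hzero _ (by simp) x hx _ (hstU _ y hy)
    let Z : Submodule (ZMod 2) W :=
      { carrier := {z | z ∈ M ∧ ∀ g : Fin l → T, ∀ y ∈ U, ω z (ρ g y) = 0}
        zero_mem' := ⟨M.zero_mem, by simp⟩
        add_mem' := fun ha hb => ⟨M.add_mem ha.1 hb.1, fun g y hy => by
          simp [ha.2 g y hy, hb.2 g y hy]⟩
        smul_mem' := fun c x hx => ⟨M.smul_mem c hx.1, fun g y hy => by
          simp [hx.2 g y hy]⟩ }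
    have hUZ : U ≤ Z := fun x hx => ⟨hUM hx, fun g y hy => hzero' g x hx y hy⟩
    have hZM : Z = M := by
      refine hM.2.2 Z (fun z hz => hz.1) (fun h _ z hz => ⟨hM.2.1 h trivial z hz.1, ?_⟩)
        (fun h => hU.1 (le_bot_iff.1 (h ▸ hUZ)))
      intro g y hy
      have h1 := hz.2 (h⁻¹ * g) y hy
      rw [← hinv h, ← Module.End.mul_apply (ρ h), ← map_mul, mul_inv_cancel_left] at h1
      exact h1
    obtain ⟨u, hu, hu0⟩ := Submodule.exists_mem_ne_zero_of_ne_bot hU.1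
    refine hu0 (hnd u (hUM hu) fun z hz => ?_)
    rw [← hZM] at hz
    have := hz.2 1 u hu
    rw [map_one, Module.End.one_apply] at this
    exact halt.isRefl _ _ this
  have heven := even_finrank_of_invariant_form σ hirr hfix
    (ω.compl₁₂ U.subtype ((ρ g).comp U.subtype))
    (fun h => hxy (LinearMap.congr_fun₂ h ⟨x, hx⟩ ⟨y, hy⟩)) (by
      intro t x y
      have hcomm : g * Pi.mulSingle i t = Pi.mulSingle i t * g := by
        ext j
        by_cases h : j = i
        · subst h; simp [hg]
        · simp [h]
      simp only [LinearMap.compl₁₂_apply, Submodule.subtype_apply, LinearMap.comp_apply, hσ]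
      rw [← Module.End.mul_apply (ρ g), ← map_mul, hcomm, map_mul, Module.End.mul_apply, hinv])
  obtain ⟨a, ha⟩ := heven
  rw [← two_mul] at ha
  have := nPrime_le_of_representation σ ha hinj hirr
  have := Module.finrank_pos (R := ZMod 2) (M := U)
  omega

/-- If every stable subspace of a symplectic `T^l`-module over the field with two elements is
nondegenerate, each factor that acts nontrivially contributes `2 * max 1 (nPrime T)` to the
dimension; the maximum keeps the bound positive without excluding the junk value `nPrime T = 0`. The
module is an orthogonal sum of minimal ones, and on a minimal one each nontrivial factor after the
first doubles the dimension. -/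
theorem card_mul_two_mul_nPrime_le_finrank (hT : ¬ ∀ a b : T, a * b = b * a)
    (ρ : Representation (ZMod 2) (Fin l → T) W) (ω : LinearMap.BilinForm (ZMod 2) W)
    (hinv : ∀ g x y, ω (ρ g x) (ρ g y) = ω x y) (halt : ω.IsAlt)
    (hnd : ∀ U : Submodule (ZMod 2) W, StableUnder ρ Set.univ U →
      ∀ x ∈ U, (∀ y ∈ U, ω x y = 0) → x = 0)
    (n : ℕ) : ∀ (U : Submodule (ZMod 2) W), StableUnder ρ Set.univ U →
      Module.finrank (ZMod 2) U = n →
      ∀ s : Finset (Fin l), (∀ i ∈ s, ∃ t, ∃ v ∈ U, ρ (Pi.mulSingle i t) v ≠ v) →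
      s.card * (2 * max 1 (nPrime T)) ≤ n := by
  classical
  induction n using Nat.strong_induction_on with
  | _ n ih =>
  intro U hst hn s hs
  by_cases hU : U = ⊥
  · have : s = ∅ := by
      refine Finset.eq_empty_of_forall_notMem fun i hi => ?_
      obtain ⟨t, v, hv, h⟩ := hs i hi
      rw [hU, Submodule.mem_bot] at hv
      exact h (by rw [hv, map_zero])
    simp [this]
  obtain ⟨M, hMU, hM⟩ := exists_minimalStable_le ρ Set.univ hU hst
  have hdisj : Disjoint M (ω.orthogonal M) := by
    rw [Submodule.disjoint_def]
    intro x hx hx'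
    exact hnd M hM.2.1 x hx fun y hy => halt.isRefl _ _ (hx' y hy)
  have hcompl := (LinearMap.BilinForm.isCompl_orthogonal_iff_disjoint halt.isRefl).2 hdisj
  set P := U ⊓ ω.orthogonal M with hPdef
  have hPst : StableUnder ρ Set.univ P := by
    refine hst.inf fun g _ v hv y hy => ?_
    have h1 : ω (ρ g⁻¹ y) v = 0 := hv _ (hM.2.1 g⁻¹ trivial y hy)
    rw [← hinv g] at h1
    simpa using h1
  have hsup : M ⊔ P = U := by
    rw [hPdef, inf_comm, ← sup_inf_assoc_of_le _ hMU, hcompl.sup_eq_top, top_inf_eq]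
  have hinf : M ⊓ P = ⊥ := by
    rw [← le_bot_iff]
    exact (inf_le_inf_left M inf_le_right).trans hdisj.le_bot
  have hsum := Submodule.finrank_sup_add_finrank_inf_eq M P
  rw [hsup, hinf, finrank_bot, add_zero, hn] at hsum
  have hMpos : 0 < Module.finrank (ZMod 2) M := by
    rw [Nat.pos_iff_ne_zero, Ne, Submodule.finrank_eq_zero]
    exact hM.1
  have hP := ih _ (by omega) P hPst rfl
    (s.filter fun i => ∃ t, ∃ v ∈ P, ρ (Pi.mulSingle i t) v ≠ v)
    (fun i hi => (Finset.mem_filter.1 hi).2)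
  set s' := s.filter fun i => ∃ t, ∃ v ∈ M, ρ (Pi.mulSingle i t) v ≠ v with hs'
  have hM' : s'.card * (2 * max 1 (nPrime T)) ≤ Module.finrank (ZMod 2) M := by
    rcases s'.eq_empty_or_nonempty with h | ⟨i, hi⟩
    · simp [h]
    have hmem : ∀ i ∈ s', ∃ t, ∃ v ∈ M, ρ (Pi.mulSingle i t) v ≠ v :=
      fun i hi => (Finset.mem_filter.1 hi).2
    have hbase := two_mul_nPrime_le_finrank_of_minimalStable ρ ω hinv hM (hnd M hM.2.1) halt i
      (hmem i hi)
    have := two_pow_mul_le_finrank_of_stableUnder (Or.inr inferInstance) ρ M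
      ((MonoidHom.mulSingle (fun _ : Fin l => T) i).range : Set (Fin l → T))
      (fun j => (MonoidHom.mulSingle (fun _ : Fin l => T) j).range) (s'.erase i)
      (fun j hj x hx b hb => commute_of_mem_range_mulSingle (Finset.ne_of_mem_erase hj).symm hx hb)
      (fun j _ j' _ hne x hx b hb => commute_of_mem_range_mulSingle hne hx hb)
      (fun j hj v hv hv' => by
        rw [commutator_range_mulSingle hT] at hv'
        refine hM.eq_zero_of_fixed _ ?_ hv hv'
        obtain ⟨t, v, hv, h⟩ := hmem j (Finset.mem_of_mem_erase hj)
        exact ⟨_, ⟨t, rfl⟩, v, hv, h⟩)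
      _ hbase M le_rfl hM.1 (hM.2.1.mono (Set.subset_univ _))
    rw [Finset.card_erase_of_mem hi] at this
    refine le_trans (Nat.mul_le_mul_right _ ?_) this
    have := Nat.lt_two_pow_self (n := s'.card - 1)
    omega
  have hcard : s.card ≤ s'.card +
      (s.filter fun i => ∃ t, ∃ v ∈ P, ρ (Pi.mulSingle i t) v ≠ v).card := by
    refine le_trans (Finset.card_le_card fun i hi => ?_) (Finset.card_union_le _ _)
    rw [Finset.mem_union, hs', Finset.mem_filter, Finset.mem_filter]
    by_contra! hno
    obtain ⟨t, v, hv, h⟩ := hs i hi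
    rw [← hsup] at hv
    obtain ⟨a, ha, b, hb, rfl⟩ := Submodule.mem_sup.1 hv
    exact h (by rw [map_add, hno.1 hi t a ha, hno.2 hi t b hb])
  calc s.card * (2 * max 1 (nPrime T)) ≤ _ := Nat.mul_le_mul_right _ hcard
    _ ≤ n := by rw [add_mul]; omega

end SymplecticPower

/-! ### Normal abelian subgroups of primitive linear groups -/

section Primitive

variable {k Γ V : Type*} [Field k] [Group Γ] [AddCommGroup V] [Module k V]

/-- The subspace on which every `a ∈ A` acts as the scalar `χ a`. -/
def weightSpace (ρ : Representation k Γ V) (A : Subgroup Γ) (χ : A → k) : Submodule k V :=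
  ⨅ a : A, Module.End.eigenspace (ρ a) (χ a)

theorem mem_weightSpace {ρ : Representation k Γ V} {A : Subgroup Γ} {χ : A → k} {v : V} :
    v ∈ weightSpace ρ A χ ↔ ∀ a : A, ρ a v = χ a • v := by
  simp [weightSpace, Submodule.mem_iInf]

variable [IsAlgClosed k] [FiniteDimensional k V] [Nontrivial V]

/-- In an irreducible linear group over an algebraically closed field that permutes no nontrivial
direct sum decomposition, normal abelian subgroups are scalar: their weight spaces are permuted,
so there is only one. -/
theorem exists_scalar_of_normal_of_commute (ρ : Representation k Γ V)
    (hirr : ∀ W : Submodule k V, StableUnder ρ Set.univ W → W = ⊥ ∨ W = ⊤)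
    (hprim : ¬ ∃ (r : ℕ) (Y : Fin r → Submodule k V), 1 < r ∧ (∀ i, Y i ≠ ⊥) ∧
      DirectSum.IsInternal Y ∧ ∀ g i, ∃ j, (Y i).map (ρ g) = Y j)
    (A : Subgroup Γ) [A.Normal] (hA : ∀ a ∈ A, ∀ b ∈ A, Commute a b) :
    ∀ a ∈ A, ∃ c : k, ∀ v, ρ a v = c • v := by
  have hnorm : A.Normal := inferInstance
  have hcommρ : ∀ a b : A, ∀ v, ρ a (ρ b v) = ρ b (ρ a v) := by
    intro a b v
    rw [← Module.End.mul_apply, ← Module.End.mul_apply, ← map_mul, ← map_mul,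
      (hA a a.2 b b.2).eq]
  have hind : iSupIndep (weightSpace ρ A) := by
    refine (Module.End.independent_iInf_maxGenEigenspace_of_forall_mapsTo
      (fun a : A => (ρ a : Module.End k V)) fun a b φ => ?_).mono fun χ => ?_
    · exact Module.End.mapsTo_maxGenEigenspace_of_comm
        (LinearMap.ext fun v => hcommρ b a v) φ
    · exact iInf_mono fun a => Module.End.eigenspace_le_maxGenEigenspace
  have hmap : ∀ g χ, ∃ χ', (weightSpace ρ A χ).map (ρ g) = weightSpace ρ A χ' := by
    have hle : ∀ g χ, (weightSpace ρ A χ).map (ρ g) ≤ weightSpace ρ A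
        (fun a => χ ⟨g⁻¹ * a * g, by simpa using hnorm.conj_mem a a.2 g⁻¹⟩) := by
      rintro g χ _ ⟨v, hv, rfl⟩
      rw [mem_weightSpace]
      intro a
      have := mem_weightSpace.1 hv ⟨g⁻¹ * a * g, by simpa using hnorm.conj_mem a a.2 g⁻¹⟩
      rw [← map_smul, ← this, ← Module.End.mul_apply, ← Module.End.mul_apply, ← map_mul,
        ← map_mul]
      congr 2
      group
    intro g χ
    refine ⟨_, le_antisymm (hle g χ) ?_⟩
    intro v hv
    refine ⟨ρ g⁻¹ v, ?_, by simp⟩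
    have h1 := hle g⁻¹ _ ⟨v, hv, rfl⟩
    convert h1 using 3 with a
    simp [mul_assoc]
  have hne : ∃ χ, weightSpace ρ A χ ≠ ⊥ := by
    obtain ⟨U, -, hU⟩ := exists_minimalStable_le ρ (A : Set Γ) (U := ⊤) top_ne_bot
      (fun _ _ _ _ => trivial)
    have : Nontrivial U := Submodule.nontrivial_iff_ne_bot.2 hU.1
    have hex : ∀ a : A, ∃ c : k, ∀ u ∈ U, ρ a u = c • u := by
      intro a
      obtain ⟨c, hc⟩ := Module.End.exists_eigenvalue ((ρ a).restrict (hU.2.1 a a.2))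
      obtain ⟨u, hu⟩ := hc.exists_hasEigenvector
      have huc : ρ a u = c • (u : V) := congrArg Subtype.val hu.apply_eq_smul
      have h := hU.2.2 (U ⊓ Module.End.eigenspace (ρ a) c) inf_le_left (by
        intro b hb v hv
        refine ⟨hU.2.1 b hb v hv.1, ?_⟩
        have h1 := Module.End.mem_eigenspace_iff.1 hv.2
        refine Module.End.mem_eigenspace_iff.2 ?_
        rw [hcommρ a ⟨b, hb⟩, h1, map_smul]) (by
        intro h
        have h2 : (u : V) ∈ U ⊓ Module.End.eigenspace (ρ a) c :=
          ⟨u.2, Module.End.mem_eigenspace_iff.2 huc⟩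
        rw [h, Submodule.mem_bot] at h2
        exact hu.2 (Subtype.ext h2))
      refine ⟨c, fun v hv => ?_⟩
      rw [← h] at hv
      exact Module.End.mem_eigenspace_iff.1 hv.2
    choose χ hχ using hex
    obtain ⟨u, hu, hu0⟩ := Submodule.exists_mem_ne_zero_of_ne_bot hU.1
    refine ⟨χ, fun h => hu0 ?_⟩
    have : u ∈ weightSpace ρ A χ := mem_weightSpace.2 fun a => hχ a u hu
    rwa [h] at this
  have htop : ⨆ χ, weightSpace ρ A χ = ⊤ := by
    refine (hirr _ fun g _ v hv => ?_).resolve_left fun h => ?_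
    · have h1 : ρ g v ∈ (⨆ χ, weightSpace ρ A χ).map (ρ g) := ⟨v, hv, rfl⟩
      rw [Submodule.map_iSup] at h1
      refine (iSup_le fun χ => ?_ : _ ≤ ⨆ χ, weightSpace ρ A χ) h1
      obtain ⟨χ', h'⟩ := hmap g χ
      rw [h']
      exact le_iSup (weightSpace ρ A) χ'
    · obtain ⟨χ, hχ⟩ := hne
      exact hχ (iSup_eq_bot.1 h χ)
  have hfin : Finite {χ : A → k // weightSpace ρ A χ ≠ ⊥} :=
    WellFoundedGT.finite_ne_bot_of_iSupIndep hind
  have hsub : Subsingleton {χ : A → k // weightSpace ρ A χ ≠ ⊥} := by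
    rw [← Finite.card_le_one_iff_subsingleton]
    by_contra! hcard
    let e := Finite.equivFin {χ : A → k // weightSpace ρ A χ ≠ ⊥}
    refine hprim ⟨_, fun i => weightSpace ρ A (e.symm i).1, hcard, fun i => (e.symm i).2, ?_, ?_⟩
    · rw [DirectSum.isInternal_submodule_iff_iSupIndep_and_iSup_eq_top]
      refine ⟨hind.comp (Subtype.val_injective.comp e.symm.injective), ?_⟩
      rw [← htop, e.symm.iSup_comp (g := fun x => weightSpace ρ A x.1)]
      refine le_antisymm (iSup_le fun χ => le_iSup _ χ.1) (iSup_le fun χ => ?_)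
      by_cases h : weightSpace ρ A χ = ⊥
      · rw [h]; exact bot_le
      · exact le_iSup (fun x : {χ : A → k // weightSpace ρ A χ ≠ ⊥} => weightSpace ρ A x.1) ⟨χ, h⟩
    · intro g i
      obtain ⟨χ', h'⟩ := hmap g (e.symm i).1
      have hχ' : weightSpace ρ A χ' ≠ ⊥ := by
        rw [← h']
        intro h
        exact (e.symm i).2 (Submodule.map_injective_of_injective (ρ.injective_apply g)
          (h.trans (Submodule.map_bot _).symm))
      exact ⟨e ⟨χ', hχ'⟩, by simpa using h'⟩
  obtain ⟨χ, hχ⟩ := hne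
  have hχtop : weightSpace ρ A χ = ⊤ := by
    rw [← htop]
    refine le_antisymm (le_iSup _ χ) (iSup_le fun χ' => ?_)
    by_cases h : weightSpace ρ A χ' = ⊥
    · rw [h]; exact bot_le
    · have := congrArg Subtype.val (hsub.elim ⟨χ', h⟩ ⟨χ, hχ⟩)
      exact (congrArg (weightSpace ρ A) this).le
  intro a ha
  refine ⟨χ ⟨a, ha⟩, fun v => ?_⟩
  have : v ∈ weightSpace ρ A χ := hχtop ▸ Submodule.mem_top
  exact mem_weightSpace.1 this ⟨a, ha⟩

end Primitive

/-! ### Scalar commutators and the duality they define -/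

section ScalarCommutators

open scoped commutatorElement

variable {k Γ : Type*} [Field k] [Group Γ]

/-- The unit `c` with `⁅g, h⁆ = ι c`; a junk value unless the commutator lies in the range of
`ι`. -/
noncomputable def commCoeff (ι : kˣ →* Γ) (g h : Γ) : kˣ :=
  Function.invFun ι ⁅g, h⁆

variable {ι : kˣ →* Γ}

theorem map_commCoeff {g h : Γ} (hgh : ⁅g, h⁆ ∈ ι.range) : ι (commCoeff ι g h) = ⁅g, h⁆ :=
  Function.invFun_eq hgh

theorem commCoeff_eq (hι : Function.Injective ι) {g h : Γ} {c : kˣ} (hc : ⁅g, h⁆ = ι c) :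
    commCoeff ι g h = c :=
  hι ((map_commCoeff ⟨c, hc.symm⟩).trans hc)

theorem commCoeff_eq_one_iff (hι : Function.Injective ι) {g h : Γ} (hgh : ⁅g, h⁆ ∈ ι.range) :
    commCoeff ι g h = 1 ↔ ⁅g, h⁆ = 1 := by
  rw [← map_commCoeff hgh, map_eq_one_iff ι hι]

theorem mul_eq_commCoeff_mul {g h : Γ} (hgh : ⁅g, h⁆ ∈ ι.range) :
    g * h = ι (commCoeff ι g h) * (h * g) := by
  rw [map_commCoeff hgh, commutatorElement_def]
  group

theorem commCoeff_swap (hι : Function.Injective ι) {g h : Γ} (hgh : ⁅g, h⁆ ∈ ι.range) :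
    commCoeff ι h g = (commCoeff ι g h)⁻¹ := by
  apply commCoeff_eq hι
  rw [map_inv, map_commCoeff hgh, commutatorElement_inv]

theorem commCoeff_map_left (hι : Function.Injective ι) (hc : ∀ c g, Commute (ι c) g) (c : kˣ)
    (g : Γ) : commCoeff ι (ι c) g = 1 := by
  apply commCoeff_eq hι
  rw [map_one, commutatorElement_eq_one_iff_commute]
  exact hc c g

theorem commCoeff_map_right (hι : Function.Injective ι) (hc : ∀ c g, Commute (ι c) g) (c : kˣ)
    (g : Γ) : commCoeff ι g (ι c) = 1 := by
  apply commCoeff_eq hι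
  rw [map_one, commutatorElement_eq_one_iff_commute]
  exact (hc c g).symm

theorem commutator_mul_right_eq (hc : ∀ c g, Commute (ι c) g) {g x y : Γ}
    (hx : ⁅g, x⁆ ∈ ι.range) (hy : ⁅g, y⁆ ∈ ι.range) :
    ⁅g, x * y⁆ = ι (commCoeff ι g x * commCoeff ι g y) := by
  have h1 : ⁅g, x * y⁆ = ⁅g, x⁆ * (x * ⁅g, y⁆ * x⁻¹) := by
    simp only [commutatorElement_def]
    group
  rw [h1, ← map_commCoeff hx, ← map_commCoeff hy, ← (hc _ x).eq, mul_inv_cancel_right, map_mul]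

theorem commCoeff_mul_right (hι : Function.Injective ι) (hc : ∀ c g, Commute (ι c) g) {g x y : Γ}
    (hx : ⁅g, x⁆ ∈ ι.range) (hy : ⁅g, y⁆ ∈ ι.range) :
    commCoeff ι g (x * y) = commCoeff ι g x * commCoeff ι g y :=
  commCoeff_eq hι (commutator_mul_right_eq hc hx hy)

theorem commutator_mem_range_symm {g x : Γ} (hx : ⁅g, x⁆ ∈ ι.range) : ⁅x, g⁆ ∈ ι.range := by
  rw [← commutatorElement_inv]
  exact inv_mem hx

theorem commutator_mul_left_eq (hι : Function.Injective ι) (hc : ∀ c g, Commute (ι c) g)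
    {g x y : Γ} (hx : ⁅x, g⁆ ∈ ι.range) (hy : ⁅y, g⁆ ∈ ι.range) :
    ⁅x * y, g⁆ = ι (commCoeff ι x g * commCoeff ι y g) := by
  rw [← commutatorElement_inv, commutator_mul_right_eq hc (commutator_mem_range_symm hx)
    (commutator_mem_range_symm hy), ← map_inv, commCoeff_swap hι hx, commCoeff_swap hι hy, mul_inv,
    inv_inv, inv_inv]

theorem commCoeff_mul_left (hι : Function.Injective ι) (hc : ∀ c g, Commute (ι c) g)
    {g x y : Γ} (hx : ⁅x, g⁆ ∈ ι.range) (hy : ⁅y, g⁆ ∈ ι.range) :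
    commCoeff ι (x * y) g = commCoeff ι x g * commCoeff ι y g :=
  commCoeff_eq hι (commutator_mul_left_eq hι hc hx hy)

theorem commCoeff_conj (hι : Function.Injective ι) (hc : ∀ c g, Commute (ι c) g) {x y : Γ}
    (hxy : ⁅x, y⁆ ∈ ι.range) (g : Γ) :
    commCoeff ι (g * x * g⁻¹) (g * y * g⁻¹) = commCoeff ι x y := by
  apply commCoeff_eq hι
  rw [← conjugate_commutatorElement, ← map_commCoeff hxy, ← (hc _ g).eq, mul_inv_cancel_right]

theorem conj_eq_commCoeff_mul {g x : Γ} (hx : ⁅g, x⁆ ∈ ι.range) :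
    g * x * g⁻¹ = ι (commCoeff ι g x) * x := by
  rw [map_commCoeff hx, commutatorElement_def]
  group

/-- The character `a ↦ ⁅g, a⁆` of a subgroup `A` whose commutators with `g` are scalars. -/
noncomputable def commCharacter (hι : Function.Injective ι) (hc : ∀ c g, Commute (ι c) g)
    (A : Subgroup Γ) (g : Γ) (hg : ∀ a ∈ A, ⁅g, a⁆ ∈ ι.range) : A →* kˣ where
  toFun a := commCoeff ι g a
  map_one' := by
    apply commCoeff_eq hι
    simp
  map_mul' a b := commCoeff_mul_right hι hc (hg a a.2) (hg b b.2)

theorem card_monoidHom_units_le (Q : Type*) [Group Q] [Finite Q] :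
    Finite (Q →* kˣ) ∧ Nat.card (Q →* kˣ) ≤ Nat.card Q := by
  have := Fintype.ofFinite Q
  have hli : LinearIndependent k (fun f : Q →* kˣ => ((Units.coeHom k).comp f : Q → k)) :=
    (linearIndependent_monoidHom Q k).comp (fun f : Q →* kˣ => (Units.coeHom k).comp f)
      (fun f g h => MonoidHom.ext fun x => Units.ext (DFunLike.congr_fun h x))
  have hfin : Finite (Q →* kˣ) := hli.finite
  have := Fintype.ofFinite (Q →* kˣ)
  refine ⟨hfin, ?_⟩
  have h := hli.fintype_card_le_finrank
  rwa [Module.finrank_fintype_fun_eq_card, ← Nat.card_eq_fintype_card, ← Nat.card_eq_fintype_card]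
    at h

/-- If `A` is abelian modulo scalars, finite modulo scalars, and only scalars are central in `A`,
then each character of `A` trivial on scalars is a commutator character `⁅a, ·⁆` with `a ∈ A`,
since there are at most `|A / scalars|` of them. -/
theorem exists_commutator_eq_of_character {H : Type*} [Group H] [Finite H] {π : Γ →* H}
    (hι : Function.Injective ι) (hc : ∀ c g, Commute (ι c) g) (hπ : π.ker = ι.range)
    (A : Subgroup Γ) (hA : ∀ a ∈ A, ∀ b ∈ A, ⁅a, b⁆ ∈ ι.range)
    (hnd : ∀ a ∈ A, (∀ b ∈ A, ⁅a, b⁆ = 1) → a ∈ ι.range)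
    (χ : A →* kˣ) (hχ : ∀ a : A, (a : Γ) ∈ ι.range → χ a = 1) :
    ∃ a ∈ A, ∀ x : A, ⁅a, (x : Γ)⁆ = ι (χ x) := by
  let R : Subgroup A := (π.comp A.subtype).ker
  have hR : ∀ a : A, a ∈ R ↔ (a : Γ) ∈ ι.range := by
    intro a
    rw [← hπ]
    rfl
  have : Finite (A ⧸ R) :=
    Finite.of_injective _ (QuotientGroup.kerLift_injective (π.comp A.subtype))
  let φ : A → (A ⧸ R →* kˣ) := fun a =>
    QuotientGroup.lift R (commCharacter hι hc A a fun b hb => hA a a.2 b hb) (by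
      intro b hb
      obtain ⟨c, hc'⟩ := (hR b).1 hb
      change commCoeff ι a b = 1
      rw [← hc', commCoeff_map_right hι hc])
  have hφ : ∀ a b : A, φ a (b : A ⧸ R) = commCoeff ι a b := fun a b => rfl
  obtain ⟨hfin, hcard⟩ := card_monoidHom_units_le (k := k) (A ⧸ R)
  have hinj : Function.Injective fun q : A ⧸ R => φ q.out := by
    intro p q hpq
    have hpq' : φ p.out = φ q.out := hpq
    rw [← p.out_eq, ← q.out_eq]
    refine QuotientGroup.eq.2 ((hR _).2 ?_)
    refine hnd _ (p.out⁻¹ * q.out).2 fun b hb => ?_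
    have hb' := DFunLike.congr_fun hpq' ((⟨b, hb⟩ : A) : A ⧸ R)
    rw [hφ, hφ] at hb'
    have h1 := commCoeff_mul_left hι hc (hA p.out p.out.2 b hb)
      (hA (p.out⁻¹ * q.out : A) (p.out⁻¹ * q.out).2 b hb)
    rw [Subgroup.coe_mul, Subgroup.coe_inv, mul_inv_cancel_left, hb', left_eq_mul] at h1
    exact (commCoeff_eq_one_iff hι (hA (p.out⁻¹ * q.out : A) (p.out⁻¹ * q.out).2 b hb)).1 h1
  obtain ⟨q, hq⟩ := (hinj.bijective_of_nat_card_le hcard).2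
    (QuotientGroup.lift R χ fun b hb => hχ b ((hR b).1 hb))
  refine ⟨q.out, q.out.2, fun x => ?_⟩
  have := DFunLike.congr_fun hq (x : A ⧸ R)
  rw [← map_commCoeff (hA _ q.out.2 _ x.2)]
  exact congrArg ι this

end ScalarCommutators

/-! ### Supplements to Heisenberg groups of odd exponent -/

section OddExponent

open scoped commutatorElement

variable {k Γ : Type*} [Field k] [Group Γ] {ι : kˣ →* Γ}

/-- The unit group of an algebraically closed field is divisible, hence injective as an abelian
group: homomorphisms into it extend from subgroups. -/
theorem baer_additive_units (k : Type*) [Field k] [IsAlgClosed k] :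
    Module.Baer ℤ (Additive kˣ) := by
  have hsurj : ∀ {n : ℤ}, n ≠ 0 → Function.Surjective fun a : Additive kˣ => n • a := by
    intro n hn a
    obtain ⟨z, hz⟩ := IsAlgClosed.exists_pow_nat_eq (a.toMul : k) (Int.natAbs_pos.2 hn)
    have hz0 : z ≠ 0 := by
      rintro rfl
      rw [zero_pow (Int.natAbs_ne_zero.2 hn)] at hz
      exact a.toMul.ne_zero hz.symm
    have hu : Units.mk0 z hz0 ^ n.natAbs = a.toMul := Units.ext (by simpa using hz)
    rcases Int.natAbs_eq n with h | h
    · refine ⟨Additive.ofMul (Units.mk0 z hz0), ?_⟩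
      change n • Additive.ofMul (Units.mk0 z hz0) = a
      rw [h, natCast_zsmul, ← ofMul_pow, hu]
      rfl
    · refine ⟨-Additive.ofMul (Units.mk0 z hz0), ?_⟩
      change n • -Additive.ofMul (Units.mk0 z hz0) = a
      rw [h, neg_smul_neg, natCast_zsmul, ← ofMul_pow, hu]
      rfl
  have : DivisibleBy (Additive kˣ) ℤ := divisibleByOfSMulRightSurj _ _ hsurj
  exact Module.Baer.of_divisible _

/-- Baer's trick: if the commutators of `A` are scalars of odd order `p`, dividing the product by
the square root `⁅x, y⁆ ^ ((p + 1) / 2)` makes `A` an abelian group, in which the divisible group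
of scalars is a direct summand. The function `r` is the projection to it. -/
theorem exists_twisted_retraction [IsAlgClosed k] (hι : Function.Injective ι)
    (hc : ∀ c g, Commute (ι c) g) (A : Subgroup Γ) (hιA : ι.range ≤ A)
    (hA : ∀ a ∈ A, ∀ b ∈ A, ⁅a, b⁆ ∈ ι.range) (h : ℕ)
    (hp : ∀ a ∈ A, ∀ b ∈ A, (commCoeff ι a b ^ h) ^ 2 = commCoeff ι a b) :
    ∃ r : Γ → kˣ, (∀ c, r (ι c) = c) ∧
      ∀ x ∈ A, ∀ y ∈ A, r (x * y) = commCoeff ι x y ^ h * (r x * r y) := by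
  let σ : A → A → kˣ := fun x y => commCoeff ι x y ^ h
  have hσr : ∀ x y z : A, σ x (y * z) = σ x y * σ x z := by
    intro x y z
    simp only [σ]
    rw [Subgroup.coe_mul, commCoeff_mul_right hι hc (hA x x.2 y y.2) (hA x x.2 z z.2), mul_pow]
  have hσl : ∀ x y z : A, σ (x * y) z = σ x z * σ y z := by
    intro x y z
    simp only [σ]
    rw [Subgroup.coe_mul, commCoeff_mul_left hι hc (hA x x.2 z z.2) (hA y y.2 z z.2), mul_pow]
  let j : kˣ →* A := ι.codRestrict A fun c => hιA ⟨c, rfl⟩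
  have hj : ∀ c (x : A), j c * x = x * j c := fun c x => Subtype.ext (hc c x).eq
  have hσjl : ∀ c x, σ (j c) x = 1 := fun c x => by
    simp only [σ]
    rw [show ((j c : A) : Γ) = ι c from rfl, commCoeff_map_left hι hc, one_pow]
  have hσjr : ∀ c x, σ x (j c) = 1 := fun c x => by
    simp only [σ]
    rw [show ((j c : A) : Γ) = ι c from rfl, commCoeff_map_right hι hc, one_pow]
  have hσ1 : ∀ x, σ 1 x = 1 := fun x => by rw [← map_one j, hσjl]
  have hσinv : ∀ x, σ x⁻¹ x = 1 := by
    intro x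
    have hxx : σ x x = 1 := by
      simp only [σ]
      rw [commCoeff_eq hι (c := 1) (by simp), one_pow]
    have := hσl x⁻¹ x x
    rw [inv_mul_cancel, hσ1, hxx, mul_one] at this
    exact this.symm
  have hswap : ∀ x y, σ y x = (σ x y)⁻¹ := fun x y => by
    simp only [σ]
    rw [commCoeff_swap hι (hA x x.2 y y.2), inv_pow]
  have hmul : ∀ x y : A, x * y = j (σ x y * σ x y) * (y * x) := by
    intro x y
    apply Subtype.ext
    have := mul_eq_commCoeff_mul (hA x x.2 y y.2)
    rw [← hp x x.2 y y.2, pow_two] at this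
    exact this
  let gadd : AddGroup A := by
    letI : Add A := ⟨fun x y => j (σ x y)⁻¹ * (x * y)⟩
    letI : Zero A := ⟨1⟩
    letI : Neg A := ⟨fun x => x⁻¹⟩
    have hadd : ∀ x y : A, x + y = j (σ x y)⁻¹ * (x * y) := fun _ _ => rfl
    have hzero : (0 : A) = 1 := rfl
    have hneg : ∀ x : A, -x = x⁻¹ := fun _ => rfl
    refine AddGroup.ofLeftAxioms (fun x y z => ?_) (fun x => ?_) (fun x => ?_)
    · simp only [hadd, hσl, hσr, hσjl, hσjr, one_mul]
      rw [← mul_assoc x (j _), ← hj _ x]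
      simp only [← mul_assoc, ← map_mul]
      congr 4
      simp only [mul_inv]
      rw [mul_comm, mul_comm (σ x z)⁻¹, mul_right_comm, mul_assoc]
    · rw [hadd, hzero, hσ1]
      simp
    · rw [hadd, hneg, hzero, hσinv]
      simp
  let cadd : AddCommGroup A :=
    { gadd with
      add_comm := fun x y => by
        change j (σ x y)⁻¹ * (x * y) = j (σ y x)⁻¹ * (y * x)
        rw [hmul x y, hswap x y, ← mul_assoc, ← map_mul]
        congr 2
        group }
  have hadd : ∀ x y : A, x + y = j (σ x y)⁻¹ * (x * y) := fun _ _ => rfl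
  let f : Additive kˣ →+ A :=
    { toFun := fun c => j c.toMul
      map_zero' := by
        change j 1 = 1
        rw [map_one]
      map_add' := fun c d => by
        rw [hadd, hσjl, toMul_add, map_mul]
        simp }
  have hf : Function.Injective f := fun c d hcd => hι (congrArg Subtype.val hcd)
  obtain ⟨r, hr⟩ := (baer_additive_units k).extension_property_addMonoidHom f hf
    (AddMonoidHom.id (Additive kˣ))
  have hrj : ∀ c, r (j c) = Additive.ofMul c := fun c => DFunLike.congr_fun hr (Additive.ofMul c)
  have hrmul : ∀ x y, r (x * y) = Additive.ofMul (σ x y) + (r x + r y) := by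
    intro x y
    have h1 : x * y = j (σ x y) + (x + y) := by
      rw [hadd, hadd, hσjl, inv_one, map_one, one_mul, ← mul_assoc, ← map_mul, mul_inv_cancel,
        map_one, one_mul]
    rw [h1, map_add, map_add, hrj]
  classical
  refine ⟨fun g => if hg : g ∈ A then (r ⟨g, hg⟩).toMul else 1, fun c => ?_, fun x hx y hy => ?_⟩
  · have hmem : ι c ∈ A := hιA ⟨c, rfl⟩
    simp only [hmem, dif_pos]
    exact hrj c
  · simp only [hx, hy, mul_mem hx hy, dif_pos]
    exact hrmul ⟨x, hx⟩ ⟨y, hy⟩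

/-- A normal subgroup `A` with scalar commutators of odd order, in which only scalars are central,
is supplemented in `Γ`: the stabilizer `K` of a twisted retraction `r` of `A` to the scalars meets
`A` in the scalars, and `A` is transitive on such retractions because the quotient of two of them
is a commutator character. -/
theorem exists_supplement_of_odd [IsAlgClosed k] {H : Type*} [Group H] [Finite H] {π : Γ →* H}
    (hι : Function.Injective ι) (hc : ∀ c g, Commute (ι c) g) (hπ : π.ker = ι.range)
    (A : Subgroup Γ) [hnorm : A.Normal] (hιA : ι.range ≤ A)
    (hA : ∀ a ∈ A, ∀ b ∈ A, ⁅a, b⁆ ∈ ι.range)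
    (hnd : ∀ a ∈ A, (∀ b ∈ A, ⁅a, b⁆ = 1) → a ∈ ι.range) (p : ℕ) (hodd : Odd p)
    (hp : ∀ a ∈ A, ∀ b ∈ A, commCoeff ι a b ^ p = 1) :
    ∃ K : Subgroup Γ, (∀ g, ∃ x ∈ K, ∃ a ∈ A, g = x * a) ∧ ∀ a ∈ A, a ∈ K → a ∈ ι.range := by
  obtain ⟨h, rfl⟩ := hodd
  obtain ⟨r, hr, hrmul⟩ := exists_twisted_retraction hι hc A hιA hA (h + 1) (fun a ha b hb => by
    rw [← pow_mul, show (h + 1) * 2 = (2 * h + 1) + 1 by ring, pow_succ, hp a ha b hb, one_mul])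
  have hrι : ∀ c, ∀ x ∈ A, r (ι c * x) = c * r x := by
    intro c x hx
    rw [hrmul _ (hιA ⟨c, rfl⟩) x hx, commCoeff_map_left hι hc, one_pow, one_mul, hr]
  have hconj : ∀ g x, x ∈ A → g * x * g⁻¹ ∈ A := fun g x hx => hnorm.conj_mem x hx g
  have hrconj : ∀ a ∈ A, ∀ x ∈ A, r (a * x * a⁻¹) = commCoeff ι a x * r x := by
    intro a ha x hx
    rw [conj_eq_commCoeff_mul (hA a ha x hx), hrι _ _ hx]
  let K : Subgroup Γ :=
    { carrier := {g | ∀ x ∈ A, r (g * x * g⁻¹) = r x}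
      one_mem' := by simp
      mul_mem' := by
        intro a b ha hb x hx
        rw [← hb x hx, ← ha _ (hconj b x hx)]
        congr 1
        group
      inv_mem' := by
        intro a ha x hx
        rw [← ha _ (hconj a⁻¹ x hx)]
        congr 1
        group }
  refine ⟨K, fun g => ?_, fun a ha haK => ?_⟩
  · let χ : A →* kˣ :=
      { toFun := fun x => r (g * x * g⁻¹) / r x
        map_one' := by simp
        map_mul' := fun x y => by
          have h1 : g * (x * y : A) * g⁻¹ = (g * x * g⁻¹) * (g * y * g⁻¹) := by
            rw [Subgroup.coe_mul]; group
          rw [h1, hrmul _ (hconj g x x.2) _ (hconj g y y.2), commCoeff_conj hι hc (hA x x.2 y y.2),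
            Subgroup.coe_mul, hrmul _ x.2 _ y.2, mul_div_mul_left_eq_div, mul_div_mul_comm] }
    obtain ⟨a, ha, hχ⟩ := exists_commutator_eq_of_character hι hc hπ A hA hnd χ (by
      rintro ⟨_, hx⟩ ⟨c, rfl⟩
      change r (g * ι c * g⁻¹) / r (ι c) = 1
      rw [← (hc c g).eq, mul_inv_cancel_right, div_self'])
    refine ⟨g * a⁻¹, fun x hx => ?_, a, ha, by group⟩
    have hy : a⁻¹ * x * a ∈ A := by simpa using hconj a⁻¹ x hx
    have h1 : r (g * (a⁻¹ * x * a) * g⁻¹) / r (a⁻¹ * x * a) = commCoeff ι a (a⁻¹ * x * a) :=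
      (commCoeff_eq hι (hχ ⟨_, hy⟩)).symm
    have h2 := hrconj a ha _ hy
    rw [← h1, div_mul_cancel] at h2
    have h3 : g * a⁻¹ * x * (g * a⁻¹)⁻¹ = g * (a⁻¹ * x * a) * g⁻¹ := by group
    rw [h3, ← h2]
    congr 1
    group
  · refine hnd a ha fun b hb => ?_
    rw [← commCoeff_eq_one_iff hι (hA a ha b hb)]
    have h1 := hrconj a ha b hb
    rw [haK b hb] at h1
    exact (right_eq_mul.1 h1)

end OddExponent

/-! ### The kernel of a minimal extension is an elementary abelian 2-group -/

section Kernel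

open scoped commutatorElement

variable {k Γ H : Type*} [Field k] [Group Γ] [Group H]

/-- `Γ` is a central extension of `H` by `kˣ` in which every normal abelian subgroup is contained
in the group of scalars `kˣ`, as is the case for the full preimage in `GL(V)` of a primitive
irreducible subgroup of `PGL(V)`. -/
structure IsPrimitiveLift (ι : kˣ →* Γ) (π : Γ →* H) : Prop where
  injective : Function.Injective ι
  commute : ∀ c g, Commute (ι c) g
  ker_eq : π.ker = ι.range
  surjective : Function.Surjective π
  le_range : ∀ A : Subgroup Γ, A.Normal → (∀ a ∈ A, ∀ b ∈ A, Commute a b) → A ≤ ι.range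

variable {ι : kˣ →* Γ} {π : Γ →* H}

namespace IsPrimitiveLift

theorem mem_range_iff (h : IsPrimitiveLift ι π) {g : Γ} : g ∈ ι.range ↔ π g = 1 := by
  rw [← h.ker_eq, MonoidHom.mem_ker]

theorem commutator_mem_range_iff (h : IsPrimitiveLift ι π) {g g' : Γ} :
    ⁅g, g'⁆ ∈ ι.range ↔ Commute (π g) (π g') := by
  rw [h.mem_range_iff, map_commutatorElement, commutatorElement_eq_one_iff_commute]

theorem range_le_comap (h : IsPrimitiveLift ι π) (B : Subgroup H) : ι.range ≤ B.comap π := by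
  intro g hg
  rw [Subgroup.mem_comap, h.mem_range_iff.1 hg]
  exact one_mem B

/-- The centre of a normal subgroup consists of scalars. -/
theorem mem_range_of_central (h : IsPrimitiveLift ι π) (B : Subgroup Γ) [B.Normal] {a : Γ}
    (ha : a ∈ B) (hcomm : ∀ b ∈ B, ⁅a, b⁆ = 1) : a ∈ ι.range := by
  refine h.le_range (B ⊓ Subgroup.centralizer B) inferInstance (fun x hx y hy => ?_)
    ⟨ha, Subgroup.mem_centralizer_iff.2 fun b hb => ?_⟩
  · exact (Subgroup.mem_centralizer_iff.1 hy.2 x hx.1)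
  · exact (commutatorElement_eq_one_iff_mul_comm.1 (hcomm b hb)).symm

theorem commCoeff_pow_left (h : IsPrimitiveLift ι π) {a b : Γ} (hab : ⁅a, b⁆ ∈ ι.range) (n : ℕ) :
    commCoeff ι (a ^ n) b = commCoeff ι a b ^ n := by
  induction n with
  | zero =>
    rw [pow_zero, pow_zero]
    exact commCoeff_eq h.injective (by simp)
  | succ n ih =>
    have : ⁅a ^ n, b⁆ ∈ ι.range := by
      rw [h.commutator_mem_range_iff, map_pow]
      exact (h.commutator_mem_range_iff.1 hab).pow_left n
    rw [pow_succ, commCoeff_mul_left h.injective h.commute this hab, ih, pow_succ]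

/-- An element whose commutators with an abelian normal `A` are scalar agrees, up to an element
of `A`, with one that centralizes the preimage of `A`. -/
theorem exists_mul_of_commute [Finite H] (h : IsPrimitiveLift ι π) (A : Subgroup Γ) [A.Normal]
    (hA : ∀ a ∈ A, ∀ b ∈ A, ⁅a, b⁆ ∈ ι.range) {g : Γ} (hg : ∀ a ∈ A, ⁅g, a⁆ ∈ ι.range) :
    ∃ a ∈ A, ∀ b ∈ A, Commute (a⁻¹ * g) b := by
  obtain ⟨a, ha, hχ⟩ := exists_commutator_eq_of_character h.injective h.commute h.ker_eq A hA
    (fun a ha => h.mem_range_of_central A ha) (commCharacter h.injective h.commute A g hg) (by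
      rintro ⟨_, _⟩ ⟨c, rfl⟩
      exact commCoeff_map_right h.injective h.commute c g)
  refine ⟨a, ha, fun b hb => ?_⟩
  have h1 : ⁅a⁻¹ * g, b⁆ ∈ ι.range := by
    rw [h.commutator_mem_range_iff, map_mul, map_inv]
    exact (h.commutator_mem_range_iff.1 (hA a ha b hb)).inv_left.mul_left
      (h.commutator_mem_range_iff.1 (hg b hb))
  have h2 := commCoeff_mul_left h.injective h.commute (hA a ha b hb) h1
  rw [mul_inv_cancel_left, commCoeff_eq h.injective (hχ ⟨b, hb⟩)] at h2
  have h3 : commCoeff ι g b = commCoeff ι g b * commCoeff ι (a⁻¹ * g) b := h2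
  rw [left_eq_mul, commCoeff_eq_one_iff h.injective h1,
    commutatorElement_eq_one_iff_commute] at h3
  exact h3

/-- A nilpotent normal subgroup `N` of `H` is abelian: the preimage of its centre is
nondegenerate, so `N` is the product of its centre and a nilpotent group `C` with trivial
centre. -/
theorem commute_of_isNilpotent [Finite H] (h : IsPrimitiveLift ι π) (N : Subgroup H) [N.Normal]
    [hN : Group.IsNilpotent N] : ∀ x ∈ N, ∀ y ∈ N, Commute x y := by
  set Z : Subgroup H := N ⊓ Subgroup.centralizer N with hZ
  set A : Subgroup Γ := Z.comap π with hAdef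
  have hZN : ∀ x ∈ Z, ∀ y ∈ N, Commute x y :=
    fun x hx y hy => (Subgroup.mem_centralizer_iff.1 hx.2 y hy).symm
  have hA : ∀ a ∈ A, ∀ b ∈ A, ⁅a, b⁆ ∈ ι.range := fun a ha b hb =>
    h.commutator_mem_range_iff.2 (hZN _ ha _ hb.1)
  set C : Subgroup Γ := N.comap π ⊓ Subgroup.centralizer A with hC
  have hdec : ∀ x ∈ N, ∃ z ∈ Z, ∃ c ∈ C, x = z * π c := by
    intro x hx
    obtain ⟨g, rfl⟩ := h.surjective x
    obtain ⟨a, ha, hcomm⟩ := h.exists_mul_of_commute A hA (g := g) fun a ha =>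
      h.commutator_mem_range_iff.2 (hZN _ ha _ hx).symm
    refine ⟨π a, ha, a⁻¹ * g, ⟨?_, Subgroup.mem_centralizer_iff.2 fun b hb => ?_⟩, by simp⟩
    · exact Subgroup.mul_mem _ (Subgroup.inv_mem _ ha.1) hx
    · exact (hcomm b hb).eq.symm
  have hCbot : C.map π = ⊥ := by
    by_contra hne
    have hle : C.map π ≤ N := by
      rintro _ ⟨c, hc, rfl⟩
      exact hc.1
    have : Group.IsNilpotent (C.map π) :=
      Group.nilpotent_of_mulEquiv (Subgroup.subgroupOfEquivOfLe hle)
    have : Nontrivial (C.map π) := (Subgroup.nontrivial_iff_ne_bot _).2 hne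
    have : Nontrivial (Subgroup.center (C.map π)) :=
      (Subgroup.nontrivial_iff_ne_bot _).2 (Group.IsNilpotent.center_ne_bot _)
    obtain ⟨⟨z, hz⟩, hz1⟩ := exists_ne (1 : Subgroup.center (C.map π))
    obtain ⟨c, hc, hcz⟩ := z.2
    have hcomm : ∀ c' ∈ C, Commute (π c) (π c') := by
      intro c' hc'
      rw [hcz]
      exact congrArg Subtype.val (Subgroup.mem_center_iff.1 hz ⟨π c', c', hc', rfl⟩).symm
    have hcA : c ∈ A := by
      refine ⟨hc.1, Subgroup.mem_centralizer_iff.2 fun x hx => ?_⟩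
      obtain ⟨y, hy, c', hc', rfl⟩ := hdec x hx
      exact ((hZN y hy _ hc.1).mul_left (hcomm c' hc').symm).eq
    have h1 := h.mem_range_of_central A hcA fun b hb => by
      rw [commutatorElement_eq_one_iff_mul_comm]
      exact (Subgroup.mem_centralizer_iff.1 hc.2 b hb).symm
    rw [h.mem_range_iff, hcz] at h1
    exact hz1 (Subtype.ext (Subtype.ext h1))
  intro x hx y hy
  obtain ⟨z, hz, c, hc, rfl⟩ := hdec x hx
  have : π c = 1 := (Subgroup.mem_bot).1 (hCbot ▸ ⟨c, hc, rfl⟩)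
  rw [this, mul_one]
  exact hZN z hz y hy

end IsPrimitiveLift

theorem IsMinimalExtension.ker_le_frattini {G : Type*} [Group G] {γ : H →* G}
    (hγ : IsMinimalExtension γ) : γ.ker ≤ frattini H := by
  refine le_iInf₂ fun M hM => ?_
  by_contra hle
  have hlt : M < M ⊔ γ.ker := lt_of_le_of_ne le_sup_left fun heq => hle (heq ▸ le_sup_right)
  have htop : M ⊔ γ.ker = ⊤ := hM.2 _ hlt
  have h1 := hγ.map_lt_top M (lt_top_iff_ne_top.2 hM.1)
  have h2 : (M ⊔ γ.ker).map γ = ⊤ := by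
    rw [htop, ← MonoidHom.range_eq_map, MonoidHom.range_eq_top.2 hγ.surjective]
  rw [Subgroup.map_sup, (Subgroup.map_eq_bot_iff _).2 le_rfl, sup_bot_eq] at h2
  exact h1.ne h2

namespace IsPrimitiveLift

variable {G : Type*} [Group G] {γ : H →* G}

theorem commute_of_mem_ker [Finite H] (h : IsPrimitiveLift ι π) (hγ : IsMinimalExtension γ) :
    ∀ x ∈ γ.ker, ∀ y ∈ γ.ker, Commute x y := by
  have := frattini_nilpotent (G := H)
  have hle := hγ.ker_le_frattini
  have : Group.IsNilpotent γ.ker :=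
    Group.nilpotent_of_mulEquiv (Subgroup.subgroupOfEquivOfLe hle)
  exact h.commute_of_isNilpotent γ.ker

/-- The elements `x` of an abelian kernel with `x ^ p = 1`. -/
def kerTorsion (γ : H →* G) (hcomm : ∀ x ∈ γ.ker, ∀ y ∈ γ.ker, Commute x y) (p : ℕ) :
    Subgroup H where
  carrier := {x | x ∈ γ.ker ∧ x ^ p = 1}
  one_mem' := ⟨one_mem _, one_pow p⟩
  mul_mem' := fun {x y} hx hy => ⟨mul_mem hx.1 hy.1, by
    rw [(hcomm x hx.1 y hy.1).mul_pow, hx.2, hy.2, one_mul]⟩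
  inv_mem' := fun {x} hx => ⟨inv_mem hx.1, by rw [inv_pow, hx.2, inv_one]⟩

/-- Elements of odd order in the kernel are trivial: the preimage of `{x ∈ γ.ker | x ^ p = 1}` has
a supplement in `Γ`, whose image in `H` maps onto `G` and hence is all of `H`. -/
theorem eq_one_of_pow_odd_eq_one [Finite H] [IsAlgClosed k] (h : IsPrimitiveLift ι π)
    (hγ : IsMinimalExtension γ) {p : ℕ} (hp : Odd p) {x : H} (hx : x ∈ γ.ker) (hxp : x ^ p = 1) :
    x = 1 := by
  have hcomm := h.commute_of_mem_ker hγ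
  let P := kerTorsion γ hcomm p
  have hP : P.Normal := ⟨fun x hx g => ⟨(inferInstance : γ.ker.Normal).conj_mem x hx.1 g, by
    rw [conj_pow, hx.2, mul_one, mul_inv_cancel]⟩⟩
  have hA : ∀ a ∈ P.comap π, ∀ b ∈ P.comap π, ⁅a, b⁆ ∈ ι.range := fun a ha b hb =>
    h.commutator_mem_range_iff.2 (hcomm _ ha.1 _ hb.1)
  obtain ⟨K, hK, hKA⟩ := exists_supplement_of_odd h.injective h.commute h.ker_eq (P.comap π)
    (h.range_le_comap P) hA (fun a ha => h.mem_range_of_central _ ha) p hp (fun a ha b hb => by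
      have hap : a ^ p ∈ ι.range := by
        rw [h.mem_range_iff, map_pow]
        exact ha.2
      obtain ⟨c, hc⟩ := hap
      rw [← h.commCoeff_pow_left (hA a ha b hb), ← hc,
        commCoeff_map_left h.injective h.commute])
  have hKtop : K.map π = ⊤ := by
    by_contra hne
    refine (hγ.map_lt_top _ (lt_top_iff_ne_top.2 hne)).ne (top_le_iff.1 fun y _ => ?_)
    obtain ⟨z, rfl⟩ := hγ.surjective y
    obtain ⟨g, rfl⟩ := h.surjective z
    obtain ⟨x, hx, a, ha, rfl⟩ := hK g
    refine ⟨π x, ⟨x, hx, rfl⟩, ?_⟩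
    have : γ (π a) = 1 := ha.1
    rw [map_mul, map_mul, this, mul_one]
  have hxK : x ∈ K.map π := hKtop ▸ Subgroup.mem_top x
  obtain ⟨g, hg, rfl⟩ := hxK
  exact h.mem_range_iff.1 (hKA g ⟨hx, hxp⟩ hg)

/-- The squares of the elements of order dividing four form a totally isotropic normal subgroup,
so they are trivial. -/
theorem sq_eq_one_of_pow_four_eq_one [Finite H] (h : IsPrimitiveLift ι π)
    (hγ : IsMinimalExtension γ) {x : H} (hx : x ∈ γ.ker) (hx4 : x ^ 4 = 1) : x ^ 2 = 1 := by
  have hcomm := h.commute_of_mem_ker hγ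
  let B : Subgroup H :=
    { carrier := {y | ∃ x ∈ γ.ker, x ^ 4 = 1 ∧ x ^ 2 = y}
      one_mem' := ⟨1, one_mem _, one_pow 4, one_pow 2⟩
      mul_mem' := by
        rintro _ _ ⟨x, hx, hx4, rfl⟩ ⟨y, hy, hy4, rfl⟩
        refine ⟨x * y, mul_mem hx hy, ?_, ?_⟩
        · rw [(hcomm x hx y hy).mul_pow, hx4, hy4, one_mul]
        · rw [(hcomm x hx y hy).mul_pow]
      inv_mem' := by
        rintro _ ⟨x, hx, hx4, rfl⟩
        exact ⟨x⁻¹, inv_mem hx, by rw [inv_pow, hx4, inv_one], inv_pow x 2⟩ }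
  have hB : B.Normal := by
    refine ⟨?_⟩
    rintro _ ⟨x, hx, hx4, rfl⟩ g
    exact ⟨g * x * g⁻¹, (inferInstance : γ.ker.Normal).conj_mem x hx g, by
      rw [conj_pow, hx4, mul_one, mul_inv_cancel], conj_pow⟩
  have hle := h.le_range (B.comap π) inferInstance (by
    rintro a ⟨x, hx, hx4, hxa⟩ b ⟨y, hy, hy4, hyb⟩
    obtain ⟨g, rfl⟩ := h.surjective x
    have hgb : ⁅g, b⁆ ∈ ι.range := h.commutator_mem_range_iff.2 (hyb ▸ hcomm _ hx _ (pow_mem hy 2))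
    have hab : ⁅a, b⁆ ∈ ι.range := h.commutator_mem_range_iff.2
      (hxa ▸ hyb ▸ hcomm _ (pow_mem hx 2) _ (pow_mem hy 2))
    obtain ⟨c, hc⟩ : a * (g ^ 2)⁻¹ ∈ ι.range := by
      rw [h.mem_range_iff, map_mul, map_inv, map_pow, hxa, mul_inv_cancel]
    obtain ⟨d, hd⟩ : b ^ 2 ∈ ι.range := by
      rw [h.mem_range_iff, map_pow, ← hyb, ← pow_mul, hy4]
    have ha : a = ι c * g ^ 2 := by rw [hc]; group
    have hb2 : commCoeff ι g b ^ 2 = 1 := by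
      rw [← inv_inj, ← inv_pow, ← commCoeff_swap h.injective hgb,
        ← h.commCoeff_pow_left (commutator_mem_range_symm hgb), ← hd,
        commCoeff_map_left h.injective h.commute, inv_one]
    have hg2 : ⁅g ^ 2, b⁆ ∈ ι.range := h.commutator_mem_range_iff.2 (by
      rw [map_pow]
      exact (h.commutator_mem_range_iff.1 hgb).pow_left 2)
    rw [← commutatorElement_eq_one_iff_commute, ← commCoeff_eq_one_iff h.injective hab, ha,
      commCoeff_mul_left h.injective h.commute _ hg2, commCoeff_map_left h.injective h.commute,
      h.commCoeff_pow_left hgb, hb2, one_mul]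
    rw [commutatorElement_eq_one_iff_commute.2 (h.commute c b)]
    exact one_mem _)
  obtain ⟨g, hg⟩ := h.surjective (x ^ 2)
  rw [← hg, ← h.mem_range_iff]
  exact hle ⟨x, hx, hx4, hg.symm⟩

theorem sq_eq_one_of_mem_ker [Finite H] [IsAlgClosed k] (h : IsPrimitiveLift ι π)
    (hγ : IsMinimalExtension γ) {x : H} (hx : x ∈ γ.ker) : x ^ 2 = 1 := by
  have hpos : 0 < orderOf x := orderOf_pos x
  obtain ⟨a, m, hm, ham⟩ := Nat.exists_eq_two_pow_mul_odd hpos.ne'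
  have h2 : x ^ 2 ^ a = 1 := by
    refine h.eq_one_of_pow_odd_eq_one hγ hm (pow_mem hx _) ?_
    rw [← pow_mul, ← ham, pow_orderOf_eq_one]
  have key : ∀ b, x ^ 2 ^ (b + 1) = 1 → x ^ 2 = 1 := by
    intro b
    induction b with
    | zero => simp
    | succ b ih =>
      intro hb
      apply ih
      have := h.sq_eq_one_of_pow_four_eq_one hγ (pow_mem hx (2 ^ b)) (by
        rw [← pow_mul, ← hb]
        congr 1
        ring)
      rw [← this, ← pow_mul, pow_succ]
  exact key a (by rw [pow_succ, pow_mul, h2, one_pow])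

end IsPrimitiveLift

end Kernel

/-! ### The kernel as a symplectic module -/

section KernelModule

open scoped commutatorElement

variable {k Γ H : Type*} [Field k] [Group Γ] [Group H]
  {ι : kˣ →* Γ} {π : Γ →* H}

/-- The isomorphism of the group of square roots of unity of a field of odd or zero characteristic
with `ZMod 2`; a junk value at other units. -/
noncomputable def signLog (c : kˣ) : ZMod 2 :=
  open scoped Classical in if c = 1 then 0 else 1

theorem signLog_eq_zero_iff {c : kˣ} : signLog c = 0 ↔ c = 1 := by
  unfold signLog
  split_ifs with h <;> simp [h]

theorem signLog_mul {c d : kˣ} (hc : c ^ 2 = 1) (hd : d ^ 2 = 1) :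
    signLog (c * d) = signLog c + signLog d := by
  have key : ∀ c : kˣ, c ^ 2 = 1 → c ≠ 1 → c = -1 := by
    intro c hc h
    have hc' : (c : k) ^ 2 = 1 := by
      rw [← Units.val_pow_eq_pow_val, hc, Units.val_one]
    rcases sq_eq_one_iff.1 hc' with h' | h'
    · exact absurd (Units.ext h') h
    · exact Units.ext h'
  by_cases h1 : c = 1
  · rw [h1, one_mul, signLog_eq_zero_iff.2 rfl, zero_add]
  by_cases h2 : d = 1
  · rw [h2, mul_one, signLog_eq_zero_iff.2 rfl, add_zero]
  have : c * d = 1 := by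
    rw [key c hc h1, key d hd h2]
    simp
  rw [this]
  simp only [signLog, h1, h2, if_true, if_false]
  decide

namespace IsPrimitiveLift

theorem commCoeff_congr (h : IsPrimitiveLift ι π) {a b a' b' : Γ} (hab : ⁅a, b⁆ ∈ ι.range)
    (ha : π a = π a') (hb : π b = π b') : commCoeff ι a b = commCoeff ι a' b' := by
  obtain ⟨c, hc⟩ : a' * a⁻¹ ∈ ι.range := by
    rw [h.mem_range_iff, map_mul, map_inv, ha, mul_inv_cancel]
  obtain ⟨d, hd⟩ : b' * b⁻¹ ∈ ι.range := by
    rw [h.mem_range_iff, map_mul, map_inv, hb, mul_inv_cancel]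
  have ha' : a' = ι c * a := by rw [hc]; group
  have hb' : b' = ι d * b := by rw [hd]; group
  have hιa : ∀ x, ⁅ι c, x⁆ ∈ ι.range := fun x => by
    rw [commutatorElement_eq_one_iff_commute.2 (h.commute c x)]
    exact one_mem _
  have hιb : ∀ x, ⁅x, ι d⁆ ∈ ι.range := fun x => by
    rw [commutatorElement_eq_one_iff_commute.2 (h.commute d x).symm]
    exact one_mem _
  have hab' : ⁅a, b'⁆ ∈ ι.range := by
    rw [h.commutator_mem_range_iff, ← hb]
    exact h.commutator_mem_range_iff.1 hab
  rw [ha', commCoeff_mul_left h.injective h.commute (hιa _) hab',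
    commCoeff_map_left h.injective h.commute, one_mul, hb',
    commCoeff_mul_right h.injective h.commute (hιb _) hab,
    commCoeff_map_right h.injective h.commute, one_mul]

/-- If `j` of the factors of `T^l` act nontrivially by conjugation on the kernel of a minimal
extension, the kernel has order at least `4 ^ (j * max 1 (nPrime T))`. -/
theorem two_pow_le_card_ker [IsAlgClosed k] [Finite H] {T : Type*} [Group T] [IsSimpleGroup T]
    (hT : ¬ ∀ a b : T, a * b = b * a) {l : ℕ} {γ : H →* (Fin l → T)} (h : IsPrimitiveLift ι π)
    (hγ : IsMinimalExtension γ) (s : Finset (Fin l))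
    (hs : ∀ i ∈ s, ∃ g : H, (∃ t, γ g = Pi.mulSingle i t) ∧ ∃ x ∈ γ.ker, ¬ Commute g x) :
    2 ^ (s.card * (2 * max 1 (nPrime T))) ≤ Nat.card γ.ker := by
  have hcomm := h.commute_of_mem_ker hγ
  have hker : γ.ker.Normal := inferInstance
  let _ : CommGroup γ.ker :=
    { (inferInstance : Group γ.ker) with
      mul_comm := fun x y => Subtype.ext (hcomm x x.2 y y.2).eq }
  let _ : Module (ZMod 2) (Additive γ.ker) := AddCommGroup.zmodModule (fun x => by
    have := h.sq_eq_one_of_mem_ker hγ x.toMul.2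
    exact congrArg Additive.ofMul (Subtype.ext this : x.toMul ^ 2 = 1))
  let W := Additive γ.ker
  let conj : H → Module.End (ZMod 2) W := fun g =>
    AddMonoidHom.toZModLinearMap 2 (MonoidHom.toAdditive (MulAut.conjNormal g).toMonoidHom)
  have hconj : ∀ g (x : W), ((conj g x).toMul : H) = g * (x.toMul : H) * g⁻¹ := fun _ _ => rfl
  have hWext : ∀ x y : W, (x.toMul : H) = (y.toMul : H) → x = y := fun x y hxy =>
    Additive.toMul.injective (Subtype.ext hxy)
  have hconj_eq : ∀ g g', γ g = γ g' → conj g = conj g' := by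
    intro g g' hgg
    refine LinearMap.ext fun x => hWext _ _ ?_
    rw [hconj, hconj]
    have hmem : g'⁻¹ * g ∈ γ.ker := by
      rw [MonoidHom.mem_ker, map_mul, map_inv, hgg, inv_mul_cancel]
    have h1 := (hcomm _ hmem _ x.toMul.2).eq
    calc g * (x.toMul : H) * g⁻¹ = g' * (g'⁻¹ * g * (x.toMul : H)) * g⁻¹ := by group
      _ = g' * (x.toMul : H) * g'⁻¹ := by rw [h1]; group
  let lift : (Fin l → T) → H := Function.surjInv hγ.surjective
  have hlift : ∀ g, γ (lift g) = g := Function.surjInv_eq hγ.surjective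
  let ρ : Representation (ZMod 2) (Fin l → T) W :=
    { toFun := fun g => conj (lift g)
      map_one' := by
        rw [hconj_eq (lift 1) 1 (by rw [hlift, map_one])]
        refine LinearMap.ext fun x => hWext _ _ ?_
        rw [hconj]
        simp
      map_mul' := fun a b => by
        rw [hconj_eq (lift (a * b)) (lift a * lift b) (by rw [map_mul, hlift, hlift, hlift])]
        refine LinearMap.ext fun x => hWext _ _ ?_
        rw [Module.End.mul_apply, hconj, hconj, hconj]
        group }
  have hρ : ∀ (g : H) x, ρ (γ g) x = conj g x := fun g x => by
    change conj (lift (γ g)) x = conj g x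
    rw [hconj_eq _ g (hlift _)]
  let up : W → Γ := fun x => Function.surjInv h.surjective (x.toMul : H)
  have hup : ∀ x, π (up x) = x.toMul := fun x => Function.surjInv_eq h.surjective _
  have hupr : ∀ x y, ⁅up x, up y⁆ ∈ ι.range := fun x y => by
    rw [h.commutator_mem_range_iff, hup, hup]
    exact hcomm _ x.toMul.2 _ y.toMul.2
  let β : W → W → kˣ := fun x y => commCoeff ι (up x) (up y)
  have hβ : ∀ (x y : W) (a b : Γ), π a = x.toMul → π b = y.toMul → β x y = commCoeff ι a b :=
    fun x y a b ha hb => h.commCoeff_congr (hupr x y) ((hup x).trans ha.symm)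
      ((hup y).trans hb.symm)
  have hβl : ∀ x y z, β (x + y) z = β x z * β y z := fun x y z => by
    rw [hβ (x + y) z (up x * up y) (up z) (by rw [map_mul, hup, hup]; rfl) (hup z),
      commCoeff_mul_left h.injective h.commute (hupr x z) (hupr y z)]
  have hβr : ∀ x y z, β x (y + z) = β x y * β x z := fun x y z => by
    rw [hβ x (y + z) (up x) (up y * up z) (hup x) (by rw [map_mul, hup, hup]; rfl),
      commCoeff_mul_right h.injective h.commute (hupr x y) (hupr x z)]
  have hβ2 : ∀ x y, β x y ^ 2 = 1 := fun x y => by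
    have h2 : up x ^ 2 ∈ ι.range := by
      rw [h.mem_range_iff, map_pow, hup]
      exact h.sq_eq_one_of_mem_ker hγ x.toMul.2
    obtain ⟨c, hc⟩ := h2
    change commCoeff ι (up x) (up y) ^ 2 = 1
    rw [← h.commCoeff_pow_left (hupr x y), ← hc, commCoeff_map_left h.injective h.commute]
  let ω : LinearMap.BilinForm (ZMod 2) W :=
    AddMonoidHom.toZModLinearMap 2
      { toFun := fun x => AddMonoidHom.toZModLinearMap 2
          { toFun := fun y => signLog (β x y)
            map_zero' := by
              have := hβr x 0 0
              rw [add_zero, left_eq_mul] at this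
              rw [this, signLog_eq_zero_iff]
            map_add' := fun y z => by
              rw [hβr, signLog_mul (hβ2 x y) (hβ2 x z)] }
        map_zero' := LinearMap.ext fun y => by
          have := hβl 0 0 y
          rw [add_zero, left_eq_mul] at this
          exact signLog_eq_zero_iff.2 this
        map_add' := fun x y => LinearMap.ext fun z => by
          change signLog (β (x + y) z) = signLog (β x z) + signLog (β y z)
          rw [hβl, signLog_mul (hβ2 x z) (hβ2 y z)] }
  have hω : ∀ x y, ω x y = signLog (β x y) := fun _ _ => rfl
  have halt : ω.IsAlt := fun x => by
    rw [hω, signLog_eq_zero_iff]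
    exact commCoeff_eq h.injective (by simp)
  have hinv : ∀ g x y, ω (ρ g x) (ρ g y) = ω x y := by
    intro g x y
    obtain ⟨g, rfl⟩ := hγ.surjective g
    obtain ⟨a, rfl⟩ := h.surjective g
    rw [hω, hω, hρ, hρ, hβ _ _ (a * up x * a⁻¹) (a * up y * a⁻¹) (by
      rw [map_mul, map_mul, map_inv, hup, hconj]) (by
      rw [map_mul, map_mul, map_inv, hup, hconj]), commCoeff_conj h.injective h.commute (hupr x y)]
  have hnd : ∀ U : Submodule (ZMod 2) W, StableUnder ρ Set.univ U →
      ∀ x ∈ U, (∀ y ∈ U, ω x y = 0) → x = 0 := by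
    intro U hU x hx hxy
    let B : Subgroup H :=
      { carrier := {g | ∃ y ∈ U, (y.toMul : H) = g}
        one_mem' := ⟨0, U.zero_mem, rfl⟩
        mul_mem' := by
          rintro _ _ ⟨y, hy, rfl⟩ ⟨z, hz, rfl⟩
          exact ⟨y + z, U.add_mem hy hz, rfl⟩
        inv_mem' := by
          rintro _ ⟨y, hy, rfl⟩
          exact ⟨-y, U.neg_mem hy, rfl⟩ }
    have hB : B.Normal := by
      refine ⟨?_⟩
      rintro _ ⟨y, hy, rfl⟩ g
      refine ⟨ρ (γ g) y, hU _ trivial y hy, ?_⟩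
      rw [hρ, hconj]
    have h1 := h.mem_range_of_central (B.comap π) (a := up x) ⟨x, hx, (hup x).symm⟩ (by
      rintro b ⟨y, hy, hyb⟩
      have hb : ⁅up x, b⁆ ∈ ι.range := by
        rw [h.commutator_mem_range_iff, hup, ← hyb]
        exact hcomm _ x.toMul.2 _ y.toMul.2
      rw [← commCoeff_eq_one_iff h.injective hb, ← hβ x y (up x) b (hup x) hyb.symm,
        ← signLog_eq_zero_iff, ← hω]
      exact hxy y hy)
    rw [h.mem_range_iff, hup] at h1
    exact hWext x 0 h1
  have hfinite : Finite W := inferInstanceAs (Finite γ.ker)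
  have key := card_mul_two_mul_nPrime_le_finrank hT ρ ω hinv halt hnd _ ⊤
    (fun _ _ _ _ => trivial) rfl s (by
      intro i hi
      obtain ⟨g, ⟨t, ht⟩, x, hx, hgx⟩ := hs i hi
      refine ⟨t, Additive.ofMul ⟨x, hx⟩, trivial, fun heq => hgx ?_⟩
      rw [← ht, hρ] at heq
      have h1 := hconj g (Additive.ofMul ⟨x, hx⟩)
      rw [heq] at h1
      have h2 : x = g * x * g⁻¹ := h1
      change g * x = x * g
      nth_rewrite 2 [h2]
      group)
  rw [finrank_top] at key
  have hcard : Nat.card γ.ker = 2 ^ Module.finrank (ZMod 2) W := by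
    have := Module.natCard_eq_pow_finrank (K := ZMod 2) (V := W)
    rwa [Nat.card_zmod] at this
  rw [hcard]
  exact Nat.pow_le_pow_right (by norm_num) key

end IsPrimitiveLift

end KernelModule

/-! ### The dimension of a primitive representation -/

section Dimension

open scoped commutatorElement

variable {k Γ H V : Type*} [Field k] [Group Γ] [Group H]
  [AddCommGroup V] [Module k V] [FiniteDimensional k V]
  {ι : kˣ →* Γ} {π : Γ →* H}

namespace IsPrimitiveLift

/-- The operators representing the elements of the kernel are linearly independent on each stable
subspace: conjugation by the kernel acts on them through distinct characters. -/
theorem card_ker_le_finrank_sq [IsAlgClosed k] [Finite H] {G : Type*} [Group G] {γ : H →* G}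
    (h : IsPrimitiveLift ι π) (hγ : IsMinimalExtension γ) (h2 : (2 : k) ≠ 0)
    (ρ : Representation k Γ V) (hρι : ∀ c v, ρ (ι c) v = (c : k) • v) {U : Submodule k V} (hU : U ≠ ⊥)
    (hst : StableUnder ρ (γ.ker.comap π) U) :
    Nat.card γ.ker ≤ Module.finrank k U ^ 2 := by
  classical
  have hcomm := h.commute_of_mem_ker hγ
  have := Fintype.ofFinite γ.ker
  let s : γ.ker → Γ := fun x => Function.surjInv h.surjective (x : H)
  have hs : ∀ x, π (s x) = x := fun x => Function.surjInv_eq h.surjective _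
  have hsr : ∀ x y, ⁅s x, s y⁆ ∈ ι.range := fun x y => by
    rw [h.commutator_mem_range_iff, hs, hs]
    exact hcomm _ x.2 _ y.2
  have hsker : ∀ x, s x ∈ γ.ker.comap π := fun x => by
    rw [Subgroup.mem_comap, hs]
    exact x.2
  have hψmul : ∀ x y z, commCoeff ι (s (y * z)) (s x) =
      commCoeff ι (s y) (s x) * commCoeff ι (s z) (s x) := fun x y z => by
    rw [← commCoeff_mul_left h.injective h.commute (hsr y x) (hsr z x)]
    exact h.commCoeff_congr (hsr _ _) (by rw [map_mul, hs, hs, hs]; rfl) rfl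
  let ψ : γ.ker → γ.ker →* kˣ := fun x =>
    { toFun := fun y => commCoeff ι (s y) (s x)
      map_one' := by
        have := hψmul x 1 1
        rw [one_mul, left_eq_mul] at this
        exact this
      map_mul' := hψmul x }
  have hψ : ∀ x y, ψ x y = commCoeff ι (s y) (s x) := fun _ _ => rfl
  have hψinj : ∀ x x₀, ψ x = ψ x₀ → x = x₀ := by
    intro x x₀ hxx
    have h1 := h.mem_range_of_central (γ.ker.comap π) (a := (s x₀)⁻¹ * s x)
      (mul_mem (inv_mem (hsker x₀)) (hsker x)) (fun b hb => by
        have hb' : π (s ⟨π b, hb⟩) = π b := hs _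
        have hab : ⁅(s x₀)⁻¹ * s x, b⁆ ∈ ι.range := by
          rw [h.commutator_mem_range_iff, map_mul, map_inv, hs, hs]
          exact hcomm _ (mul_mem (inv_mem x₀.2) x.2) _ hb
        have hxb : ∀ z, ⁅s z, b⁆ ∈ ι.range := fun z => by
          rw [h.commutator_mem_range_iff, hs]
          exact hcomm _ z.2 _ hb
        have hval : ∀ z, commCoeff ι (s z) b = (ψ z ⟨π b, hb⟩)⁻¹ := fun z => by
          rw [hψ, ← commCoeff_swap h.injective (hsr _ _)]
          exact h.commCoeff_congr (hxb z) rfl hb'.symm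
        have h3 := commCoeff_mul_left h.injective h.commute (hxb x₀) hab
        rw [mul_inv_cancel_left, hval, hval, hxx, left_eq_mul,
          commCoeff_eq_one_iff h.injective hab] at h3
        exact h3)
    rw [h.mem_range_iff, map_mul, map_inv, hs, hs, inv_mul_eq_one] at h1
    exact Subtype.ext h1.symm
  have hcard : (Fintype.card γ.ker : k) ≠ 0 := by
    have hp : IsPGroup 2 γ.ker := fun x =>
      ⟨1, Subtype.ext (by simpa using h.sq_eq_one_of_mem_ker hγ x.2)⟩
    obtain ⟨n, hn⟩ := IsPGroup.iff_card.1 hp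
    rw [← Nat.card_eq_fintype_card, hn, Nat.cast_pow, Nat.cast_ofNat]
    exact pow_ne_zero n h2
  let E : γ.ker → Module.End k U := fun x => (ρ (s x)).restrict (hst _ (hsker x))
  obtain ⟨u, hu, hu0⟩ := Submodule.exists_mem_ne_zero_of_ne_bot hU
  have hli : LinearIndependent k E := by
    rw [Fintype.linearIndependent_iff]
    intro c hc x₀
    have hrel : ∀ v ∈ U, ∑ x, c x • ρ (s x) v = 0 := by
      intro v hv
      have h1 := congrArg (fun e : Module.End k U => ((e ⟨v, hv⟩ : U) : V)) hc
      simpa [E, LinearMap.sum_apply] using h1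
    have hrel' : ∀ y, ∑ x, (c x * ψ x y) • ρ (s x) u = 0 := by
      intro y
      have h1 := congrArg (ρ (s y)) (hrel (ρ (s y)⁻¹ u) (hst _ (inv_mem (hsker y)) u hu))
      rw [map_zero, map_sum] at h1
      rw [← h1]
      refine Finset.sum_congr rfl fun x _ => ?_
      rw [map_smul, ← Module.End.mul_apply, ← Module.End.mul_apply, ← map_mul, ← map_mul,
        conj_eq_commCoeff_mul (hsr y x), map_mul, Module.End.mul_apply, hρι, mul_smul]
      rfl
    -- averaging against the character of `x₀` isolates its coefficient
    have havg : ∑ y, ((ψ x₀ y)⁻¹ : kˣ).1 • ∑ x, (c x * ψ x y) • ρ (s x) u = 0 := by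
      simp [hrel']
    have hsum : ∀ x, ∑ y, (((ψ x₀ y)⁻¹ : kˣ) : k) * (c x * ψ x y) =
        if x = x₀ then (Fintype.card γ.ker : k) * c x else 0 := by
      intro x
      have h1 : ∀ y, (((ψ x₀ y)⁻¹ : kˣ) : k) * (c x * ψ x y) =
          c x * ((Units.coeHom k).comp (ψ x / ψ x₀)) y := by
        intro y
        simp only [MonoidHom.comp_apply, MonoidHom.div_apply, Units.coeHom_apply,
          div_eq_mul_inv, Units.val_mul]
        ring
      simp_rw [h1]
      rw [← Finset.mul_sum]
      split_ifs with hx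
      · subst hx
        simp [mul_comm]
      · rw [sum_hom_units_eq_zero, mul_zero]
        intro heq
        apply hx
        apply hψinj
        rw [← div_eq_one]
        exact MonoidHom.ext fun y => Units.ext (DFunLike.congr_fun heq y)
    simp_rw [Finset.smul_sum, smul_smul] at havg
    rw [Finset.sum_comm] at havg
    simp_rw [← Finset.sum_smul, hsum, ite_smul, zero_smul] at havg
    rw [Finset.sum_ite_eq' Finset.univ x₀, if_pos (Finset.mem_univ _), smul_eq_zero,
      mul_eq_zero] at havg
    rcases havg with (h3 | h3) | h3
    · exact absurd h3 hcard
    · exact h3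
    · exact absurd (ρ.injective_apply _ (h3.trans (map_zero _).symm)) hu0
  have h3 := hli.fintype_card_le_finrank
  rw [Module.finrank_linearMap, ← pow_two, ← Nat.card_eq_fintype_card] at h3
  exact h3

section Factors

variable {T : Type*} [Group T] {l : ℕ} {γ : H →* (Fin l → T)}

/-- The elements of `Γ` that lie over the `i`-th factor of `T^l` and commute with everything over
the kernel. -/
def factorCentralizer (π : Γ →* H) (γ : H →* (Fin l → T)) (i : Fin l) : Subgroup Γ :=
  ((MonoidHom.mulSingle (fun _ : Fin l => T) i).range.comap γ).comap π ⊓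
    Subgroup.centralizer (γ.ker.comap π)

instance normal_factorCentralizer (i : Fin l) : (factorCentralizer π γ i).Normal :=
  inferInstanceAs (((MonoidHom.mulSingle (fun _ : Fin l => T) i).range.comap γ).comap π ⊓
    Subgroup.centralizer (γ.ker.comap π) : Subgroup Γ).Normal

theorem commute_of_mem_factorCentralizer {i : Fin l} {x b : Γ}
    (hx : x ∈ γ.ker.comap π) (hb : b ∈ factorCentralizer π γ i) : Commute x b :=
  Subgroup.mem_centralizer_iff.1 hb.2 x hx

/-- Elements of different factor centralizers commute up to scalars, so their commutators define
characters, which are trivial on derived subgroups. -/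
theorem commute_of_mem_commutator_factorCentralizer (h : IsPrimitiveLift ι π) {i j : Fin l}
    (hij : i ≠ j) {x b : Γ} (hx : x ∈ ⁅factorCentralizer π γ i, factorCentralizer π γ i⁆)
    (hb : b ∈ factorCentralizer π γ j) : Commute x b := by
  have hr : ∀ x ∈ factorCentralizer π γ i, ⁅b, x⁆ ∈ ι.range := by
    intro x hx
    refine h.mem_range_of_central (γ.ker.comap π) ?_ fun y hy => ?_
    · rw [Subgroup.mem_comap, MonoidHom.mem_ker, map_commutatorElement, map_commutatorElement,
        commutatorElement_eq_one_iff_commute]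
      exact (commute_of_mem_range_mulSingle hij hx.1 hb.1).symm
    · rw [commutatorElement_eq_one_iff_commute]
      have h1 := (commute_of_mem_factorCentralizer hy hb).symm
      have h2 := (commute_of_mem_factorCentralizer hy hx).symm
      exact ((h1.mul_left h2).mul_left h1.inv_left).mul_left h2.inv_left
  let χ := commCharacter h.injective h.commute (factorCentralizer π γ i) b hr
  have hle : ⁅factorCentralizer π γ i, factorCentralizer π γ i⁆ ≤
      Subgroup.centralizer {b} := by
    rw [Subgroup.commutator_le]
    intro y hy z hz
    have h1 : χ ⁅(⟨y, hy⟩ : factorCentralizer π γ i), ⟨z, hz⟩⁆ = 1 := by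
      rw [map_commutatorElement, commutatorElement_eq_one_iff_commute]
      exact Commute.all _ _
    have hmem : ⁅y, z⁆ ∈ factorCentralizer π γ i :=
      (⁅(⟨y, hy⟩ : factorCentralizer π γ i), ⟨z, hz⟩⁆ : factorCentralizer π γ i).2
    have h2 : ⁅b, ⁅y, z⁆⁆ = 1 := (commCoeff_eq_one_iff h.injective (hr _ hmem)).1 h1
    rw [Subgroup.mem_centralizer_singleton_iff]
    exact (commutatorElement_eq_one_iff_mul_comm.1 h2).symm
  exact Subgroup.mem_centralizer_singleton_iff.1 (hle hx)

/-- If everything over the `i`-th factor commutes with the kernel, its factor centralizer maps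
onto the factor, and so does the second derived subgroup of the factor centralizer. -/
theorem range_mulSingle_le_map [Finite H] [IsSimpleGroup T] (hT : ¬ ∀ a b : T, a * b = b * a)
    (h : IsPrimitiveLift ι π) (hγ : IsMinimalExtension γ) {i : Fin l}
    (hi : ∀ g : H, (∃ t, γ g = Pi.mulSingle i t) → ∀ x ∈ γ.ker, Commute g x) :
    (MonoidHom.mulSingle (fun _ : Fin l => T) i).range ≤
      ⁅⁅factorCentralizer π γ i, factorCentralizer π γ i⁆,
        ⁅factorCentralizer π γ i, factorCentralizer π γ i⁆⁆.map (γ.comp π) := by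
  have hcomm := h.commute_of_mem_ker hγ
  have h1 : (MonoidHom.mulSingle (fun _ : Fin l => T) i).range ≤
      (factorCentralizer π γ i).map (γ.comp π) := by
    rintro _ ⟨t, rfl⟩
    obtain ⟨y, hy⟩ := hγ.surjective (Pi.mulSingle i t)
    obtain ⟨g, rfl⟩ := h.surjective y
    obtain ⟨a, ha, hab⟩ := h.exists_mul_of_commute (γ.ker.comap π)
      (fun a ha b hb => h.commutator_mem_range_iff.2 (hcomm _ ha _ hb)) (g := g)
      (fun a ha => h.commutator_mem_range_iff.2 (hi _ ⟨t, hy⟩ _ ha))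
    have hval : γ (π (a⁻¹ * g)) = Pi.mulSingle i t := by
      have : γ (π a) = 1 := ha
      rw [map_mul, map_inv, map_mul, map_inv, this, inv_one, one_mul, hy]
    refine ⟨a⁻¹ * g, ⟨⟨t, hval.symm⟩, Subgroup.mem_centralizer_iff.2 fun b hb => ?_⟩, hval⟩
    exact (hab b hb).eq.symm
  have h2 := Subgroup.commutator_mono h1 h1
  rw [commutator_range_mulSingle hT, ← Subgroup.map_commutator] at h2
  have h3 := Subgroup.commutator_mono h2 h2
  rwa [commutator_range_mulSingle hT, ← Subgroup.map_commutator] at h3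

/-- A central kernel element generates a cyclic normal subgroup, whose preimage is abelian and
hence scalar. So if no factor acted nontrivially on the kernel, the kernel would be trivial. -/
theorem exists_factor_not_commute [Finite H] (h : IsPrimitiveLift ι π) (hγ : IsMinimalExtension γ)
    (hne : γ.ker ≠ ⊥) :
    ∃ i, ∃ g : H, (∃ t, γ g = Pi.mulSingle i t) ∧ ∃ x ∈ γ.ker, ¬ Commute g x := by
  classical
  by_contra! hall
  apply hne
  have hcomm := h.commute_of_mem_ker hγ
  have hmap : (Subgroup.centralizer (γ.ker : Set H)).map γ = ⊤ := by
    rw [eq_top_iff]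
    intro y _
    refine Subgroup.pi_mem_of_mulSingle_mem y fun i => ?_
    obtain ⟨g, hg⟩ := hγ.surjective (Pi.mulSingle i (y i))
    exact ⟨g, Subgroup.mem_centralizer_iff.2 fun x hx => (hall i g ⟨_, hg⟩ x hx).eq.symm, hg⟩
  have htop : Subgroup.centralizer (γ.ker : Set H) = ⊤ := by
    by_contra hlt
    exact (hγ.map_lt_top _ (lt_top_iff_ne_top.2 hlt)).ne hmap
  rw [eq_bot_iff]
  intro x hx
  have hxc : ∀ g : H, Commute x g := fun g =>
    Subgroup.mem_centralizer_iff.1 (htop ▸ Subgroup.mem_top g :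
      g ∈ Subgroup.centralizer (γ.ker : Set H)) x hx
  have hnorm : (Subgroup.zpowers x).Normal := by
    refine ⟨?_⟩
    rintro _ ⟨n, rfl⟩ g
    refine ⟨n, ?_⟩
    have := ((hxc g).zpow_left n).eq
    change x ^ n = g * x ^ n * g⁻¹
    rw [← this, mul_inv_cancel_right]
  obtain ⟨a, rfl⟩ := h.surjective x
  have h1 := h.mem_range_of_central ((Subgroup.zpowers (π a)).comap π) (a := a)
    (Subgroup.mem_zpowers (π a)) (by
      rintro b ⟨n, hn⟩
      obtain ⟨c, hc⟩ : b * (a ^ n)⁻¹ ∈ ι.range := by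
        rw [h.mem_range_iff, map_mul, map_inv, map_zpow, ← hn]
        exact mul_inv_cancel _
      have hb : b = ι c * a ^ n := by rw [hc]; group
      rw [commutatorElement_eq_one_iff_commute, hb]
      exact (h.commute c a).symm.mul_right ((Commute.refl a).zpow_right n))
  exact h.mem_range_iff.1 h1

/-- In characteristic two the commutators of the kernel, being square roots of unity, are
trivial. -/
theorem ker_eq_bot_of_charTwo [IsAlgClosed k] [Finite H] [CharP k 2]
    (h : IsPrimitiveLift ι π) (hγ : IsMinimalExtension γ) :
    γ.ker = ⊥ := by
  have hcomm := h.commute_of_mem_ker hγ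
  have hr : ∀ a ∈ γ.ker.comap π, ∀ b ∈ γ.ker.comap π, ⁅a, b⁆ ∈ ι.range := fun a ha b hb =>
    h.commutator_mem_range_iff.2 (hcomm _ ha _ hb)
  have hle := h.le_range (γ.ker.comap π) inferInstance fun a ha b hb => by
    rw [← commutatorElement_eq_one_iff_commute, ← commCoeff_eq_one_iff h.injective (hr a ha b hb)]
    obtain ⟨c, hc⟩ : a ^ 2 ∈ ι.range := by
      rw [h.mem_range_iff, map_pow]
      exact h.sq_eq_one_of_mem_ker hγ ha
    have h1 : commCoeff ι a b ^ 2 = 1 := by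
      rw [← h.commCoeff_pow_left (hr a ha b hb), ← hc, commCoeff_map_left h.injective h.commute]
    have h2 : ((commCoeff ι a b : kˣ) : k) ^ 2 = 1 := by
      rw [← Units.val_pow_eq_pow_val, h1, Units.val_one]
    apply Units.ext
    rcases sq_eq_one_iff.1 h2 with h3 | h3
    · exact h3
    · rw [h3, CharTwo.neg_eq, Units.val_one]
  rw [eq_bot_iff]
  intro x hx
  obtain ⟨a, rfl⟩ := h.surjective x
  exact h.mem_range_iff.1 (hle hx)

/-- The factors acting nontrivially on the kernel bound its order and thereby the dimension of the
subspaces stable under it; each remaining factor doubles these dimensions. -/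
theorem mul_two_pow_nPrime_le_finrank [IsAlgClosed k] [Finite H] [IsSimpleGroup T]
    (hT : ¬ ∀ a b : T, a * b = b * a) [Nontrivial V]
    (h : IsPrimitiveLift ι π) (hγ : IsMinimalExtension γ) (hne : γ.ker ≠ ⊥)
    (h2 : (2 : k) ≠ 0) (ρ : Representation k Γ V) (hρ : Function.Injective ρ)
    (hρι : ∀ c v, ρ (ι c) v = (c : k) • v)
    (hirr : ∀ W : Submodule k V, StableUnder ρ Set.univ W → W = ⊥ ∨ W = ⊤) :
    l * 2 ^ nPrime T ≤ Module.finrank k V := by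
  classical
  have hmin : MinimalStable ρ Set.univ (⊤ : Submodule k V) :=
    ⟨top_ne_bot, fun _ _ _ _ => trivial, fun W _ hW hne => (hirr W hW).resolve_left hne⟩
  let J : Finset (Fin l) := Finset.univ.filter fun i =>
    ∃ g : H, (∃ t, γ g = Pi.mulSingle i t) ∧ ∃ x ∈ γ.ker, ¬ Commute g x
  have hJ : J.Nonempty := by
    obtain ⟨i, hi⟩ := h.exists_factor_not_commute hγ hne
    exact ⟨i, Finset.mem_filter.2 ⟨Finset.mem_univ i, hi⟩⟩
  have hJc : ∀ i ∈ Jᶜ, ∀ g : H, (∃ t, γ g = Pi.mulSingle i t) → ∀ x ∈ γ.ker, Commute g x := by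
    intro i hi g hg x hx
    by_contra hgx
    exact Finset.mem_compl.1 hi (Finset.mem_filter.2 ⟨Finset.mem_univ i, g, hg, x, hx, hgx⟩)
  have hker := h.two_pow_le_card_ker hT hγ J fun i hi => (Finset.mem_filter.1 hi).2
  have hbase : ∀ U ≤ (⊤ : Submodule k V), U ≠ ⊥ → StableUnder ρ (γ.ker.comap π) U →
      2 ^ (J.card * max 1 (nPrime T)) ≤ Module.finrank k U := by
    intro U _ hU hst
    have h1 := hker.trans (h.card_ker_le_finrank_sq hγ h2 ρ hρι hU hst)
    rw [show J.card * (2 * max 1 (nPrime T)) = J.card * max 1 (nPrime T) * 2 by ring,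
      pow_mul] at h1
    exact (Nat.pow_le_pow_iff_left (by norm_num)).1 h1
  let B : Fin l → Subgroup Γ := fun i => ⁅factorCentralizer π γ i, factorCentralizer π γ i⁆
  have hB : ∀ i, B i ≤ factorCentralizer π γ i := fun i =>
    Subgroup.commutator_le_left _ _
  have key := two_pow_mul_le_finrank_of_stableUnder (Or.inl inferInstance) ρ ⊤ (γ.ker.comap π) B
    Jᶜ (fun i _ x hx b hb => commute_of_mem_factorCentralizer hx (hB i hb))
    (fun i _ j _ hij x hx b hb => h.commute_of_mem_commutator_factorCentralizer hij hx (hB j hb))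
    (fun i hi v hv hfix => by
      refine hmin.eq_zero_of_fixed ⁅B i, B i⁆ ?_ hv hfix
      obtain ⟨t, ht⟩ := exists_ne (1 : T)
      obtain ⟨g, hg, hgt⟩ := range_mulSingle_le_map hT h hγ (hJc i hi) ⟨t, rfl⟩
      refine ⟨g, hg, ?_⟩
      by_contra! hall
      have hg1 : g = 1 := hρ (by
        rw [map_one]
        exact LinearMap.ext fun w => hall w trivial)
      rw [hg1, map_one] at hgt
      exact ht (Pi.mulSingle_eq_one_iff.1 hgt.symm))
    _ hbase ⊤ le_rfl top_ne_bot (fun _ _ _ _ => trivial)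
  rw [finrank_top] at key
  refine le_trans ?_ key
  have hcard : J.card + Jᶜ.card = l := by
    rw [Finset.card_add_card_compl, Fintype.card_fin]
  have hq := hJ.card_pos
  have hn : 1 ≤ max 1 (nPrime T) := le_max_left _ _
  have hn' : nPrime T ≤ max 1 (nPrime T) := le_max_right _ _
  generalize max 1 (nPrime T) = n at *
  obtain ⟨q, hq'⟩ := Nat.exists_eq_add_of_le' hq
  obtain ⟨n', rfl⟩ := Nat.exists_eq_add_of_le' hn
  -- `l ≤ 2 ^ (l - 1)`, and `q + n - 1 ≤ q * n` for `q, n ≥ 1`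
  have hexp : (l - 1) + (n' + 1) ≤ Jᶜ.card + J.card * (n' + 1) := by
    have : J.card * (n' + 1) = q * n' + q + n' + 1 := by rw [hq']; ring
    omega
  have hl : l ≤ 2 ^ (l - 1) := by
    have := Nat.lt_two_pow_self (n := l - 1)
    omega
  calc l * 2 ^ nPrime T ≤ 2 ^ (l - 1) * 2 ^ (n' + 1) :=
        Nat.mul_le_mul hl (Nat.pow_le_pow_right (by norm_num) hn')
    _ = 2 ^ ((l - 1) + (n' + 1)) := (pow_add _ _ _).symm
    _ ≤ 2 ^ (Jᶜ.card + J.card * (n' + 1)) := Nat.pow_le_pow_right (by norm_num) hexp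
    _ = _ := pow_add _ _ _

end Factors

end IsPrimitiveLift

end Dimension

/-! ### Projective representations as primitive lifts -/

namespace ProjRep

variable {H k : Type*} [Group H] [Field k] {m : ℕ}

theorem naturalRep_injective (k : Type*) [Field k] (m : ℕ) :
    Function.Injective (naturalRep k m) := by
  intro g g' h
  exact Matrix.GeneralLinearGroup.toLin.injective (Units.ext h)

theorem naturalRep_scalar (c : kˣ) (v : Fin m → k) :
    naturalRep k m (Matrix.GeneralLinearGroup.scalar (Fin m) c) v = (c : k) • v := by
  ext i
  simp [naturalRep]

/-- The scalars, as elements of the full preimage in `GL_m(k)`. -/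
def scalarHom (lam : H →* PGL(Fin m, k)) : kˣ →* linearPreimage lam :=
  (Matrix.GeneralLinearGroup.scalar (Fin m)).codRestrict _ fun c => by
    rw [linearPreimage, Subgroup.mem_comap, Matrix.ProjGenLinGroup.mk_scalar]
    exact one_mem _

/-- The projection of the full preimage in `GL_m(k)` to the group that is represented. -/
noncomputable def projection {lam : H →* PGL(Fin m, k)} (hlam : Function.Injective lam) :
    linearPreimage lam →* H :=
  (MonoidHom.ofInjective hlam).symm.toMonoidHom.comp
    (Matrix.ProjGenLinGroup.mk.subgroupComap lam.range)

theorem lam_projection {lam : H →* PGL(Fin m, k)} (hlam : Function.Injective lam)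
    (g : linearPreimage lam) :
    lam (projection hlam g) = Matrix.ProjGenLinGroup.mk (g : GL (Fin m) k) :=
  congrArg Subtype.val ((MonoidHom.ofInjective hlam).apply_symm_apply
    (Matrix.ProjGenLinGroup.mk.subgroupComap lam.range g))

/-- The action of the full preimage on `k^m`. -/
def linearRep (lam : H →* PGL(Fin m, k)) : Representation k (linearPreimage lam) (Fin m → k) :=
  (naturalRep k m).comp (linearPreimage lam).subtype

theorem linearRep_injective (lam : H →* PGL(Fin m, k)) : Function.Injective (linearRep lam) :=
  (naturalRep_injective k m).comp Subtype.val_injective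

theorem linearRep_scalarHom (lam : H →* PGL(Fin m, k)) (c : kˣ) (v : Fin m → k) :
    linearRep lam (scalarHom lam c) v = (c : k) • v :=
  naturalRep_scalar c v

theorem IsIrreducible.nontrivial {lam : H →* PGL(Fin m, k)} (hirr : IsIrreducible lam) :
    Nontrivial (Fin m → k) := by
  obtain ⟨⟨W, W', hne⟩⟩ := hirr.toNontrivial
  by_contra hsub
  rw [not_nontrivial_iff_subsingleton] at hsub
  exact hne (Subrepresentation.toSubmodule_injective (Subsingleton.elim _ _))

theorem IsIrreducible.eq_bot_or_eq_top {lam : H →* PGL(Fin m, k)} (hirr : IsIrreducible lam)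
    (W : Submodule k (Fin m → k)) (hW : StableUnder (linearRep lam) Set.univ W) :
    W = ⊥ ∨ W = ⊤ := by
  have h : IsSimpleOrder (Subrepresentation (linearRep lam)) := hirr
  exact (h.eq_bot_or_eq_top ⟨W, fun g v hv => hW g trivial v hv⟩).imp
    (congrArg Subrepresentation.toSubmodule) (congrArg Subrepresentation.toSubmodule)

/-- The full preimage of a faithful irreducible primitive projective representation is a primitive
lift of the represented group. -/
theorem isPrimitiveLift [IsAlgClosed k] {lam : H →* PGL(Fin m, k)} (hlam : Function.Injective lam)
    (hirr : IsIrreducible lam) (hprim : IsPrimitive lam) :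
    IsPrimitiveLift (scalarHom lam) (projection hlam) := by
  have := hirr.nontrivial
  obtain ⟨v, hv⟩ := exists_ne (0 : Fin m → k)
  refine ⟨fun c d hcd => ?_, fun c g => ?_, ?_, fun x => ?_, fun A hA hcomm a ha => ?_⟩
  · have h1 := linearRep_scalarHom lam c v
    rw [hcd, linearRep_scalarHom] at h1
    exact Units.ext (smul_left_injective k hv h1).symm
  · apply linearRep_injective
    rw [map_mul, map_mul]
    refine LinearMap.ext fun w => ?_
    rw [Module.End.mul_apply, Module.End.mul_apply, linearRep_scalarHom, linearRep_scalarHom,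
      map_smul]
  · ext g
    rw [MonoidHom.mem_ker, ← map_eq_one_iff lam hlam, lam_projection,
      Matrix.ProjGenLinGroup.mk_eq_one, Matrix.GeneralLinearGroup.center_eq_range_scalar]
    constructor
    · rintro ⟨c, hc⟩
      exact ⟨c, Subtype.ext hc⟩
    · rintro ⟨c, rfl⟩
      exact ⟨c, rfl⟩
  · obtain ⟨g, hg⟩ := Matrix.ProjGenLinGroup.mk_surjective (lam x)
    exact ⟨⟨g, x, hg.symm⟩, hlam ((lam_projection hlam _).trans hg)⟩
  · obtain ⟨c, hc⟩ := exists_scalar_of_normal_of_commute (linearRep lam) hirr.eq_bot_or_eq_top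
      (by
        rintro ⟨r, Y, hr, hY, hint, hperm⟩
        exact hprim ⟨r, Y, hr, hY, hint, fun g hg i => hperm ⟨g, hg⟩ i⟩) A hcomm a ha
    have hc0 : c ≠ 0 := by
      rintro rfl
      have h1 := hc v
      rw [zero_smul] at h1
      exact hv ((linearRep lam).injective_apply a (h1.trans (map_zero _).symm))
    refine ⟨Units.mk0 c hc0, linearRep_injective lam (LinearMap.ext fun w => ?_)⟩
    rw [linearRep_scalarHom, hc w, Units.val_mk0]

end ProjRep

theorem corollary5 {k : Type*} [Field k] [IsAlgClosed k]
    {T : Type*} [Group T] [Finite T] [IsSimpleGroup T] (hT : ¬ ∀ a b : T, a * b = b * a)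
    {l : ℕ} (hl : 0 < l)
    {H : Type*} [Group H] [Finite H] (γ : H →* (Fin l → T))
    (hmin : IsMinimalExtension γ) (hproper : ¬ Function.Bijective γ) :
    (CharP k 2 →
      ¬ ∃ (m : ℕ) (lam : H →* PGL(Fin m, k)),
        Function.Injective lam ∧ ProjRep.IsIrreducible lam ∧ ProjRep.IsPrimitive lam) ∧
    (¬ CharP k 2 →
      ∀ (m : ℕ) (lam : H →* PGL(Fin m, k)),
        Function.Injective lam → ProjRep.IsIrreducible lam → ProjRep.IsPrimitive lam →
          l * 2 ^ nPrime T ≤ m) := by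
  have hne : γ.ker ≠ ⊥ := fun h =>
    hproper ⟨(MonoidHom.ker_eq_bot_iff γ).1 h, hmin.surjective⟩
  refine ⟨fun hchar => ?_, fun hchar m lam hlam hirr hprim => ?_⟩
  · rintro ⟨m, lam, hlam, hirr, hprim⟩
    exact hne ((ProjRep.isPrimitiveLift hlam hirr hprim).ker_eq_bot_of_charTwo hmin)
  · have := hirr.nontrivial
    have h := (ProjRep.isPrimitiveLift hlam hirr hprim).mul_two_pow_nPrime_le_finrank hT hmin hne
      (fun h2 => hchar (CharTwo.of_one_ne_zero_of_two_eq_zero one_ne_zero h2))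
      (ProjRep.linearRep lam) (ProjRep.linearRep_injective lam) (ProjRep.linearRep_scalarHom lam)
      hirr.eq_bot_or_eq_top
    rwa [Module.finrank_fin_fun] at h
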